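/- For $n\ge 2$ and a simple graph $G$ on the vertex set $[n]=\{1,\dots,n\}$ let $Y_{ij}=+1$ if $ij$ is an edge of $G$, $Y_{ij}=-1$ if $i\ne j$ and $ij$ is not an edge, and $Y_{ii}=0$; put $k_i=\sum_{j=1}^n Y_{ij}$. For $\theta>0$ and $\boldsymbol\beta\in\mathbb R^n$ the degree-corrected two-star model is the probability distribution on graphs $$\mathbb P_{n,\theta,\boldsymbol\beta}(G)=\frac1{Z_n(\boldsymbol\beta,\theta)}\exp\Big\{\frac{\theta}{n-1}\sum_{i=1}^n\sum_{j<k}Y_{ij}Y_{ik}+\frac12\sum_{i=1}^n\beta_ik_i\Big\},$$ where $Z_n(\boldsymbol\beta,\theta)$ is the normalizing constant. For $\beta_0\in\mathbb R$ and $s,A>0$ let $\Xi_n(s,A)$ be the set of vectors $\beta_0\mathbf 1+\boldsymbol\mu$, $\boldsymbol\mu\in\mathbb R^n$, with $|\operatorname{supp}\boldsymbol\mu|\ge s$ and $\mu_i\ge A$ for all $i\in\operatorname{supp}\boldsymbol\mu$. A (nonrandomized) test of $\boldsymbol\beta=\beta_0\mathbf 1$ against $\boldsymbol\beta\in\Xi_n(s,A)$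 is a function $T_n$ from the graphs on $[n]$ to $\{0,1\}$, with risk $$R_n(T_n)=\mathbb P_{n,\theta,\beta_0\mathbf 1}(T_n=1)+\sup_{\boldsymbol\beta\in\Xi_n(s,A)}\mathbb P_{n,\theta,\boldsymbol\beta}(T_n=0).$$ For $s=s_n$ and $A=A_n$, a sequence of tests $(T_n)$ is asymptotically powerful if $\lim_{n\to\infty}R_n(T_n)=0$, and asymptotically not powerful if $\liminf_{n\to\infty}R_n(T_n)>0$. Theorem. Let $(\theta,\beta_0)=(\tfrac12,0)$, and let $s=n^b$ and $A=n^t$ with fixed $b\in(0,1)$ and $t<0$. (a) If $b+t+\tfrac12<0$, then every sequence of tests is asymptotically not powerful. (b) If $b+t+\tfrac12>0$, then there is a sequence $(L_n)$ with $L_n/n^{3/2}\to\infty$ such that the total degree test, $T_n(G)=1$ if $\sum_{i=1}^nk_i>L_n$ and $T_n(G)=0$ otherwise, is asymptotically powerful. -/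

import Mathlib

open Filter Topology

noncomputable section

namespace TwoStar

open Classical in
/-- The `±1` adjacency matrix `Y` of a simple graph on `n` labelled vertices: `+1` for an edge, `-1`
for a non-edge, and `0` on the diagonal. -/
def adj {n : ℕ} (G : SimpleGraph (Fin n)) (i j : Fin n) : ℝ :=
  if i = j then 0 else if G.Adj i j then 1 else -1

/-- The `±1` degree `k_i = ∑_j Y_ij`. -/
def deg {n : ℕ} (G : SimpleGraph (Fin n)) (i : Fin n) : ℝ :=
  ∑ j, adj G i j

/-- The `±1` two-star count `∑_i ∑_{j<k} Y_ij Y_ik`. -/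
def twoStars {n : ℕ} (G : SimpleGraph (Fin n)) : ℝ :=
  ∑ i, ∑ j, ∑ k ∈ Finset.Ioi j, adj G i j * adj G i k

/-- The unnormalised probability mass of `G` in the degree-corrected two-star model. -/
def weight {n : ℕ} (θ : ℝ) (β : Fin n → ℝ) (G : SimpleGraph (Fin n)) : ℝ :=
  Real.exp (θ / ((n : ℝ) - 1) * twoStars G + 1 / 2 * ∑ i, β i * deg G i)

open Classical in
/-- The normalising constant `Z_n(β, θ)`. -/
def partitionFunction {n : ℕ} (θ : ℝ) (β : Fin n → ℝ) : ℝ :=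
  ∑ G : SimpleGraph (Fin n), weight θ β G

/-- The probability mass function of the degree-corrected two-star model. -/
def mass {n : ℕ} (θ : ℝ) (β : Fin n → ℝ) (G : SimpleGraph (Fin n)) : ℝ :=
  weight θ β G / partitionFunction θ β

open Classical in
/-- The probability of an event (a set of graphs) in the degree-corrected two-star model. -/
def prob {n : ℕ} (θ : ℝ) (β : Fin n → ℝ) (E : Set (SimpleGraph (Fin n))) : ℝ :=
  ∑ G : SimpleGraph (Fin n), if G ∈ E then mass θ β G else 0

/-- The alternative `Ξ(s, A)`: the vectors `β₀ 1 + μ` with `|supp μ| ≥ s` and `μ_i ≥ A` for every `i`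
in `supp μ`. -/
def alternatives (n : ℕ) (β₀ s A : ℝ) : Set (Fin n → ℝ) :=
  {β | ∃ μ : Fin n → ℝ, (∀ i, β i = β₀ + μ i) ∧
    s ≤ ((Function.support μ).ncard : ℝ) ∧ ∀ i ∈ Function.support μ, A ≤ μ i}

/-- The risk of a nonrandomised test: the type I error plus the worst type II error over `Ξ(s, A)`. -/
def risk {n : ℕ} (θ β₀ s A : ℝ) (T : SimpleGraph (Fin n) → Fin 2) : ℝ :=
  prob θ (fun _ => β₀) {G | T G = 1} +
    sSup ((fun β => prob θ β {G | T G = 0}) '' alternatives n β₀ s A)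

/-- A sequence of tests is asymptotically powerful (signal sizes `s n`, strengths `A n`) if its risk
tends to `0`. -/
def AsympPowerful (θ β₀ : ℝ) (s A : ℕ → ℝ) (T : ∀ n, SimpleGraph (Fin n) → Fin 2) : Prop :=
  Tendsto (fun n => risk θ β₀ (s n) (A n) (T n)) atTop (𝓝 0)

/-- A sequence of tests is asymptotically not powerful if the lower limit of its risk is positive. -/
def AsympNotPowerful (θ β₀ : ℝ) (s A : ℕ → ℝ) (T : ∀ n, SimpleGraph (Fin n) → Fin 2) : Prop :=
  0 < liminf (fun n => risk θ β₀ (s n) (A n) (T n)) atTop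

open Classical in
/-- The total degree test, which rejects (takes the value `1`) when `∑_i k_i > L`. -/
def totalDegreeTest {n : ℕ} (L : ℝ) (G : SimpleGraph (Fin n)) : Fin 2 :=
  if L < ∑ i, deg G i then 1 else 0

end TwoStar

end

namespace TwoStar

open Real

/-! ### Elementary inequalities for the hyperbolic tangent -/

/-! Given all other pairs, `Y_ij` has mean `tanh h_ij` with `h_ij` the local field
(`expect_adj_eq_expect_tanh`). The point `(1/2, 0)` is critical: when `tanh` is linearised and the
mean equations are summed over pairs, the total mean degree `K` cancels, and only `K / (n - 1)`
survives, because `Y_ij` is excluded from its own field. Write `σ = ∑ β_i`, so that `σ` is of order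
`n ^ (b + t)` for the smallest alternatives.

Upper bound. Since `x - tanh x` is increasing, the FKG inequality lets the linearised equation bound
increments of the means: a nonnegative change `δ` of the field moves each mean degree by at most `2
n ∑ δ` (`meanDeg_add_le`). Convexity of the log-partition function turns this into sub-Gaussian
bounds: linear statistics `∑ δ_i k_i / 2` have exponential moments at most `exp (n (∑ δ)²)` after
centring. If `n σ² ≤ 1`, the likelihood ratio stays nondegenerate and no test works
(`one_eighth_le_errors`), which is (a).

Lower bound. From `tanh x ≥ x - x₊³ / 2`, the term `n σ` is controlled by `K / n`, `√n`, `K³ / n⁴`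
and terms negligible against `n σ` (`field_le_meanDeg`). When `n σ` is of order `n ^ (1/2 + 4η)`,
this forces `K ≥ 2 n ^ (3/2 + η)`, beyond the `n ^ (3/2)` fluctuation scale, and Chernoff bounds
give (b). Stochastic monotonicity in the field reduces the composite alternative to blocks of
minimal size. -/

theorem monotone_sub_tanh : Monotone fun x : ℝ => x - tanh x := by
  have key : ∀ x : ℝ, HasDerivAt (fun x : ℝ => x - tanh x)
      (1 - (cosh x * cosh x - sinh x * sinh x) / cosh x ^ 2) x := by
    intro x
    have h := (hasDerivAt_id x).sub
      ((Real.hasDerivAt_sinh x).div (Real.hasDerivAt_cosh x) (Real.cosh_pos x).ne')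
    refine h.congr_of_eventuallyEq (Eventually.of_forall fun y => ?_)
    simp [Real.tanh_eq_sinh_div_cosh]
  refine monotone_of_deriv_nonneg (fun x => (key x).differentiableAt) fun x => ?_
  rw [(key x).deriv, sub_nonneg, div_le_one (by have := Real.cosh_pos x; positivity)]
  nlinarith [mul_self_nonneg (sinh x)]

theorem tanh_le_self {x : ℝ} (hx : 0 ≤ x) : tanh x ≤ x := by
  have := monotone_sub_tanh hx
  simp only [Real.tanh_zero, sub_zero] at this
  linarith

theorem self_le_tanh {x : ℝ} (hx : x ≤ 0) : x ≤ tanh x := by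
  have := monotone_sub_tanh hx
  simp only [Real.tanh_zero, sub_zero] at this
  linarith

theorem sinh_le_mul_cosh {x : ℝ} (hx : 0 ≤ x) : sinh x ≤ x * cosh x := by
  have := tanh_le_self hx
  rwa [Real.tanh_eq_sinh_div_cosh, div_le_iff₀ (Real.cosh_pos x)] at this

/-- Only the positive part is cubed, so upper exponential moments of the local field suffice later.
For `x ≥ 0` the bound follows from `x ≤ sinh x` and `cosh x - 1 ≤ (x² / 2) cosh x`. -/
theorem sub_cube_le_tanh (x : ℝ) : x - max x 0 ^ 3 / 2 ≤ tanh x := by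
  rcases le_total x 0 with hx | hx
  · simpa [max_eq_right hx] using self_le_tanh hx
  rw [max_eq_left hx, Real.tanh_eq_sinh_div_cosh, le_div_iff₀ (Real.cosh_pos x)]
  have h1 : x ≤ sinh x := Real.self_le_sinh_iff.2 hx
  have h2 := sinh_le_mul_cosh (x := x / 2) (by linarith)
  have h3 : 0 ≤ sinh (x / 2) := Real.sinh_nonneg_iff.2 (by linarith)
  have h4 : cosh x = cosh (x / 2) ^ 2 + sinh (x / 2) ^ 2 := by
    rw [← Real.cosh_two_mul]; ring_nf
  have h5 := Real.cosh_sq (x / 2)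
  have h6 : sinh (x / 2) ^ 2 ≤ (x / 2 * cosh (x / 2)) ^ 2 := by gcongr
  have h7 : cosh (x / 2) ^ 2 ≤ cosh x := by nlinarith [sq_nonneg (sinh (x / 2))]
  have h8 : cosh x - 1 ≤ x ^ 2 / 2 * cosh x := by nlinarith [sq_nonneg x]
  nlinarith

/-! ### Expectations -/

section Expect

open Classical in
/-- The expectation of a function of the graph in the degree-corrected two-star model. -/
noncomputable def expect {n : ℕ} (θ : ℝ) (β : Fin n → ℝ) (f : SimpleGraph (Fin n) → ℝ) : ℝ :=
  ∑ G : SimpleGraph (Fin n), mass θ β G * f G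

variable {n : ℕ} {θ : ℝ} {β β' δ : Fin n → ℝ} {f g : SimpleGraph (Fin n) → ℝ}

theorem weight_pos (θ : ℝ) (β : Fin n → ℝ) (G : SimpleGraph (Fin n)) : 0 < weight θ β G :=
  Real.exp_pos _

theorem partitionFunction_pos (θ : ℝ) (β : Fin n → ℝ) : 0 < partitionFunction θ β := by
  classical
  exact Finset.sum_pos (fun G _ => weight_pos θ β G) ⟨⊥, Finset.mem_univ _⟩

theorem mass_pos (θ : ℝ) (β : Fin n → ℝ) (G : SimpleGraph (Fin n)) : 0 < mass θ β G :=
  div_pos (weight_pos θ β G) (partitionFunction_pos θ β)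

theorem expect_const (θ : ℝ) (β : Fin n → ℝ) (c : ℝ) : expect θ β (fun _ => c) = c := by
  classical
  have h := (partitionFunction_pos θ β).ne'
  simp only [expect, mass]
  rw [← Finset.sum_mul, ← Finset.sum_div]
  have : (∑ G : SimpleGraph (Fin n), weight θ β G) = partitionFunction θ β := by
    unfold partitionFunction; congr!
  rw [this, div_self h, one_mul]

theorem expect_add (θ : ℝ) (β : Fin n → ℝ) (f g : SimpleGraph (Fin n) → ℝ) :
    expect θ β (fun G => f G + g G) = expect θ β f + expect θ β g := by
  simp [expect, mul_add, Finset.sum_add_distrib]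

theorem expect_sub (θ : ℝ) (β : Fin n → ℝ) (f g : SimpleGraph (Fin n) → ℝ) :
    expect θ β (fun G => f G - g G) = expect θ β f - expect θ β g := by
  simp [expect, mul_sub, Finset.sum_sub_distrib]

theorem expect_const_mul (θ : ℝ) (β : Fin n → ℝ) (c : ℝ) (f : SimpleGraph (Fin n) → ℝ) :
    expect θ β (fun G => c * f G) = c * expect θ β f := by
  simp only [expect, Finset.mul_sum]
  exact Finset.sum_congr rfl fun _ _ => by ring

theorem expect_neg (θ : ℝ) (β : Fin n → ℝ) (f : SimpleGraph (Fin n) → ℝ) :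
    expect θ β (fun G => - f G) = - expect θ β f := by
  simp [expect]

theorem expect_sum {ι : Type*} (θ : ℝ) (β : Fin n → ℝ) (s : Finset ι)
    (f : ι → SimpleGraph (Fin n) → ℝ) :
    expect θ β (fun G => ∑ i ∈ s, f i G) = ∑ i ∈ s, expect θ β (f i) := by
  simp only [expect, Finset.mul_sum]
  exact Finset.sum_comm

theorem expect_mono (h : ∀ G, f G ≤ g G) : expect θ β f ≤ expect θ β g :=
  Finset.sum_le_sum fun G _ => mul_le_mul_of_nonneg_left (h G) (mass_pos θ β G).le

theorem exp_expect_le (θ : ℝ) (β : Fin n → ℝ) (f : SimpleGraph (Fin n) → ℝ) :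
    exp (expect θ β f) ≤ expect θ β (fun G => exp (f G)) := by
  have h : expect θ β (fun G => exp (expect θ β f) * ((f G - expect θ β f) + 1)) ≤
      expect θ β (fun G => exp (f G)) := by
    refine expect_mono fun G => ?_
    calc _ ≤ exp (expect θ β f) * exp (f G - expect θ β f) :=
          mul_le_mul_of_nonneg_left (Real.add_one_le_exp _) (Real.exp_pos _).le
      _ = _ := by rw [← Real.exp_add]; ring_nf
  rw [expect_const_mul, expect_add, expect_sub, expect_const, expect_const] at h
  linarith

theorem prob_eq_expect (θ : ℝ) (β : Fin n → ℝ) (E : Set (SimpleGraph (Fin n)))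
    [∀ G, Decidable (G ∈ E)] :
    prob θ β E = expect θ β (fun G => if G ∈ E then 1 else 0) := by
  unfold prob expect
  exact Finset.sum_congr rfl fun G _ => by by_cases h : G ∈ E <;> simp [h]

theorem prob_nonneg (θ : ℝ) (β : Fin n → ℝ) (E : Set (SimpleGraph (Fin n))) :
    0 ≤ prob θ β E := by
  classical
  unfold prob
  exact Finset.sum_nonneg fun G _ => by split_ifs <;> simp [(mass_pos θ β G).le]

theorem prob_le_expect {E : Set (SimpleGraph (Fin n))} (hf : ∀ G, 0 ≤ f G)
    (hE : ∀ G ∈ E, 1 ≤ f G) : prob θ β E ≤ expect θ β f := by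
  classical
  rw [prob_eq_expect]
  refine expect_mono fun G => ?_
  split_ifs with h
  exacts [hE G h, hf G]

theorem prob_le_one (θ : ℝ) (β : Fin n → ℝ) (E : Set (SimpleGraph (Fin n))) :
    prob θ β E ≤ 1 :=
  (prob_le_expect (f := fun _ => 1) (by simp) (by simp)).trans_eq (expect_const θ β 1)

/-! ### Tilting the field -/

theorem weight_add (θ : ℝ) (β δ : Fin n → ℝ) (G : SimpleGraph (Fin n)) :
    weight θ (β + δ) G = weight θ β G * exp (1 / 2 * ∑ i, δ i * deg G i) := by
  rw [weight, weight, ← Real.exp_add]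
  congr 1
  simp only [Pi.add_apply, add_mul, Finset.sum_add_distrib]
  ring

/-- Exponential tilting by a linear statistic of the degrees stays inside the model and only shifts
the field. -/
theorem expect_exp_mul (θ : ℝ) (β δ : Fin n → ℝ) (f : SimpleGraph (Fin n) → ℝ) :
    expect θ β (fun G => exp (1 / 2 * ∑ i, δ i * deg G i) * f G) =
      expect θ β (fun G => exp (1 / 2 * ∑ i, δ i * deg G i)) * expect θ (β + δ) f := by
  classical
  have h1 := (partitionFunction_pos θ β).ne'
  have h2 := (partitionFunction_pos θ (β + δ)).ne'
  have h3 : expect θ β (fun G => exp (1 / 2 * ∑ i, δ i * deg G i)) =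
      partitionFunction θ (β + δ) / partitionFunction θ β := by
    simp only [expect, mass, div_mul_eq_mul_div _ (partitionFunction θ β)]
    rw [← Finset.sum_div]
    congr 1
    unfold partitionFunction
    exact Finset.sum_congr (by congr!) fun G _ => (weight_add θ β δ G).symm
  rw [h3]
  simp only [expect, mass]
  rw [Finset.mul_sum]
  refine Finset.sum_congr rfl fun G _ => ?_
  rw [weight_add]
  generalize exp (1 / 2 * ∑ i, δ i * deg G i) = c
  field_simp

theorem expect_exp_pos (θ : ℝ) (β : Fin n → ℝ) (f : SimpleGraph (Fin n) → ℝ) :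
    0 < expect θ β (fun G => exp (f G)) :=
  (Real.exp_pos _).trans_le (exp_expect_le θ β f)

/-- With `X` the exponent, the tilted mean of `exp (-X)` is the reciprocal of the left side; Jensen
under the tilted law finishes. Exponential moments are thereby reduced to mean degrees at the field
`β + δ`. -/
theorem expect_exp_tilt_le (θ : ℝ) (β δ : Fin n → ℝ) :
    expect θ β (fun G => exp (1 / 2 * ∑ i, δ i * deg G i)) ≤
      exp (expect θ (β + δ) (fun G => 1 / 2 * ∑ i, δ i * deg G i)) := by
  have h := expect_exp_mul θ β δ (fun G => exp (- (1 / 2 * ∑ i, δ i * deg G i)))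
  have h1 : expect θ β (fun G => exp (1 / 2 * ∑ i, δ i * deg G i) *
      exp (- (1 / 2 * ∑ i, δ i * deg G i))) = 1 := by
    simp only [← Real.exp_add, add_neg_cancel, Real.exp_zero, expect_const]
  rw [h1] at h
  have h2 := exp_expect_le θ (β + δ) (fun G => - (1 / 2 * ∑ i, δ i * deg G i))
  rw [expect_neg, Real.exp_neg] at h2
  have h3 := expect_exp_pos θ β (fun G => 1 / 2 * ∑ i, δ i * deg G i)
  have h4 := mul_le_mul_of_nonneg_left h2 h3.le
  rw [← h] at h4
  rwa [← div_eq_mul_inv, div_le_one (Real.exp_pos _)] at h4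

end Expect

/-! ### The adjacency matrix and the lattice of graphs -/

section Lattice

variable {n : ℕ} {θ : ℝ} {β β' : Fin n → ℝ}

theorem adj_self (G : SimpleGraph (Fin n)) (i : Fin n) : adj G i i = 0 := by simp [adj]

theorem adj_comm (G : SimpleGraph (Fin n)) (i j : Fin n) : adj G i j = adj G j i := by
  have h1 := G.adj_comm i j
  have h2 := eq_comm (a := i) (b := j)
  unfold adj
  split_ifs <;> first | rfl | (exfalso; tauto)

theorem adj_sq (G : SimpleGraph (Fin n)) {i j : Fin n} (h : i ≠ j) : adj G i j ^ 2 = 1 := by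
  unfold adj; rw [if_neg h]; split_ifs <;> norm_num

theorem neg_one_le_adj (G : SimpleGraph (Fin n)) (i j : Fin n) : -1 ≤ adj G i j := by
  unfold adj; split_ifs <;> norm_num

theorem adj_mono (i j : Fin n) : Monotone fun G : SimpleGraph (Fin n) => adj G i j := by
  intro G H h
  have := @h i j
  simp only [adj]
  split_ifs <;> first | (norm_num; done) | (exfalso; tauto)

theorem deg_mono (i : Fin n) : Monotone fun G : SimpleGraph (Fin n) => deg G i :=
  fun _ _ h => Finset.sum_le_sum fun j _ => adj_mono i j h

theorem adj_inf (G H : SimpleGraph (Fin n)) (i j : Fin n) :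
    adj (G ⊓ H) i j = min (adj G i j) (adj H i j) := by
  have := SimpleGraph.inf_adj G H i j
  simp only [adj]
  split_ifs <;> first | (norm_num; done) | (exfalso; tauto)

theorem adj_sup (G H : SimpleGraph (Fin n)) (i j : Fin n) :
    adj (G ⊔ H) i j = max (adj G i j) (adj H i j) := by
  have := SimpleGraph.sup_adj G H i j
  simp only [adj]
  split_ifs <;> first | (norm_num; done) | (exfalso; tauto)

theorem deg_inf_add_deg_sup (G H : SimpleGraph (Fin n)) (i : Fin n) :
    deg (G ⊓ H) i + deg (G ⊔ H) i = deg G i + deg H i := by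
  simp only [deg, ← Finset.sum_add_distrib, adj_inf, adj_sup, min_add_max]

theorem mul_add_mul_le_min_max (a b c d : ℝ) :
    a * b + c * d ≤ min a c * min b d + max a c * max b d := by
  rcases le_total a c with h | h <;> rcases le_total b d with h' | h' <;>
    simp only [min_eq_left, min_eq_right, max_eq_left, max_eq_right, h, h'] <;> nlinarith

theorem twoStars_supermodular (G H : SimpleGraph (Fin n)) :
    twoStars G + twoStars H ≤ twoStars (G ⊓ H) + twoStars (G ⊔ H) := by
  simp only [twoStars, ← Finset.sum_add_distrib, adj_inf, adj_sup]
  exact Finset.sum_le_sum fun i _ => Finset.sum_le_sum fun j _ => Finset.sum_le_sum fun k _ =>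
    mul_add_mul_le_min_max _ _ _ _

theorem weight_log_supermodular (hθ : 0 ≤ θ / ((n : ℝ) - 1)) (β : Fin n → ℝ)
    (G H : SimpleGraph (Fin n)) :
    weight θ β G * weight θ β H ≤ weight θ β (G ⊓ H) * weight θ β (G ⊔ H) := by
  simp only [weight, ← Real.exp_add]
  refine Real.exp_le_exp.2 ?_
  have h1 := mul_le_mul_of_nonneg_left (twoStars_supermodular G H) hθ
  have h2 : ∑ i, β i * deg G i + ∑ i, β i * deg H i =
      ∑ i, β i * deg (G ⊓ H) i + ∑ i, β i * deg (G ⊔ H) i := by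
    simp only [← Finset.sum_add_distrib, ← mul_add, deg_inf_add_deg_sup]
  linarith

/-- The Fortuin–Kasteleyn–Ginibre inequality: increasing functions are positively correlated. -/
theorem expect_mul_expect_le (hθ : 0 ≤ θ / ((n : ℝ) - 1)) {f g : SimpleGraph (Fin n) → ℝ}
    (hf : Monotone f) (hg : Monotone g) :
    expect θ β f * expect θ β g ≤ expect θ β (fun G => f G * g G) := by
  classical
  have hbot : ∀ G : SimpleGraph (Fin n), ⊥ ≤ G := fun G => bot_le
  -- `fkg` asks for nonnegative functions; subtracting the value at the least graph leaves the
  -- covariance unchanged.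
  have h := fkg (fun G => f G - f ⊥) (fun G => g G - g ⊥) (mass θ β)
    (fun G => (mass_pos θ β G).le) (fun G => sub_nonneg.2 (hf (hbot G)))
    (fun G => sub_nonneg.2 (hg (hbot G))) (fun _ _ h => sub_le_sub_right (hf h) _)
    (fun _ _ h => sub_le_sub_right (hg h) _) (fun G H => by
      have hZ := partitionFunction_pos θ β
      simp only [mass, div_mul_div_comm]
      exact div_le_div_of_nonneg_right (weight_log_supermodular hθ β G H) (by positivity))
  have h' : expect θ β (fun G => f G - f ⊥) * expect θ β (fun G => g G - g ⊥) ≤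
      expect θ β (fun _ => 1) * expect θ β (fun G => (f G - f ⊥) * (g G - g ⊥)) := by
    simp only [expect, mul_one]
    convert h
  have e : (fun G => (f G - f ⊥) * (g G - g ⊥)) =
      fun G => (f G * g G - g ⊥ * f G) - (f ⊥ * g G - f ⊥ * g ⊥) := by
    funext G; ring
  rw [e, expect_sub, expect_sub, expect_sub, expect_sub, expect_sub, expect_const_mul,
    expect_const_mul] at h'
  simp only [expect_const] at h'
  linarith

/-- Stochastic monotonicity in the field. -/
theorem expect_mono_field (hθ : 0 ≤ θ / ((n : ℝ) - 1)) (hβ : ∀ i, β i ≤ β' i)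
    {f : SimpleGraph (Fin n) → ℝ} (hf : Monotone f) : expect θ β f ≤ expect θ β' f := by
  have e : β' = β + (β' - β) := by simp
  have hmono : Monotone fun G : SimpleGraph (Fin n) =>
      exp (1 / 2 * ∑ i, (β' - β) i * deg G i) := by
    intro G H h
    refine Real.exp_le_exp.2 (mul_le_mul_of_nonneg_left (Finset.sum_le_sum fun i _ => ?_)
      (by norm_num))
    exact mul_le_mul_of_nonneg_left (deg_mono i h) (by simpa using hβ i)
  have h := expect_mul_expect_le (β := β) hθ hmono hf
  rw [expect_exp_mul, ← e] at h
  exact le_of_mul_le_mul_left h (expect_exp_pos θ β _)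

end Lattice

/-! ### The two-star count through degrees -/

theorem sum_sq_eq_sum_sq_add {n : ℕ} (a : Fin n → ℝ) :
    (∑ j, a j) ^ 2 = ∑ j, a j ^ 2 + 2 * ∑ j, ∑ k ∈ Finset.Ioi j, a j * a k := by
  have h1 : ∀ j, ∑ k, a j * a k =
      ∑ k ∈ Finset.Iio j, a j * a k + a j ^ 2 + ∑ k ∈ Finset.Ioi j, a j * a k := by
    intro j
    have hl : (Finset.univ : Finset (Fin n)) = Finset.Iio j ∪ {j} ∪ Finset.Ioi j := by
      ext k; simp; omega
    have d1 : Disjoint (Finset.Iio j) {j} := by simp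
    have d2 : Disjoint (Finset.Iio j ∪ {j}) (Finset.Ioi j) := by
      rw [Finset.disjoint_left]; intro k; simp
    rw [hl, Finset.sum_union d2, Finset.sum_union d1, Finset.sum_singleton, sq]
  have h2 : ∑ j, ∑ k ∈ Finset.Iio j, a j * a k = ∑ j, ∑ k ∈ Finset.Ioi j, a j * a k := by
    rw [Finset.sum_comm' (t' := Finset.univ) (s' := fun k => Finset.Ioi k) (by simp)]
    exact Finset.sum_congr rfl fun j _ => Finset.sum_congr rfl fun k _ => mul_comm _ _
  rw [sq, Finset.sum_mul_sum, Finset.sum_congr rfl fun j _ => h1 j]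
  rw [Finset.sum_add_distrib, Finset.sum_add_distrib, h2]
  ring

theorem twoStars_eq {n : ℕ} (G : SimpleGraph (Fin n)) :
    twoStars G = ∑ i, (deg G i ^ 2 - ((n : ℝ) - 1)) / 2 := by
  unfold twoStars
  refine Finset.sum_congr rfl fun i _ => ?_
  have h := sum_sq_eq_sum_sq_add (adj G i)
  have h2 : ∑ j, adj G i j ^ 2 = (n : ℝ) - 1 := by
    have : ∀ j, adj G i j ^ 2 = 1 - if i = j then 1 else 0 := by
      intro j
      split_ifs with hij
      · simp [← hij, adj_self]
      · simp [adj_sq G hij]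
    simp [this]
  rw [h2] at h
  unfold deg
  linarith

/-! ### Toggling an edge -/

/-- The graph in which the pair `i j` has been switched between edge and non-edge. -/
def toggle {n : ℕ} (i j : Fin n) (G : SimpleGraph (Fin n)) : SimpleGraph (Fin n) :=
  symmDiff (SimpleGraph.edge i j) G

section Toggle

variable {n : ℕ} {i j : Fin n}

theorem toggle_involutive (i j : Fin n) : Function.Involutive (toggle i j) :=
  symmDiff_right_involutive _

theorem adj_toggle (hij : i ≠ j) (G : SimpleGraph (Fin n)) (u v : Fin n) :
    adj (toggle i j G) u v = adj G u v - 2 * adj G i j *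
      ((if u = i then 1 else 0) * (if v = j then 1 else 0) +
        (if u = j then 1 else 0) * (if v = i then 1 else 0)) := by
  have h : (toggle i j G).Adj u v ↔
      ((u = i ∧ v = j ∨ u = j ∧ v = i) ∧ ¬ G.Adj u v) ∨
      (¬ (u = i ∧ v = j ∨ u = j ∧ v = i) ∧ G.Adj u v) := by
    have hne : G.Adj u v → u ≠ v := fun h => h.ne
    have hne2 : (u = i ∧ v = j ∨ u = j ∧ v = i) → u ≠ v := by
      rintro (⟨rfl, rfl⟩ | ⟨rfl, rfl⟩)
      exacts [hij, hij.symm]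
    simp only [toggle, symmDiff, SimpleGraph.sup_adj, SimpleGraph.sdiff_adj, SimpleGraph.edge_adj]
    tauto
  by_cases h1 : u = i ∧ v = j
  · obtain ⟨rfl, rfl⟩ := h1
    have h' : (toggle u v G).Adj u v ↔ ¬ G.Adj u v := by rw [h]; tauto
    by_cases hg : G.Adj u v <;> simp [adj, hij, hij.symm, h', hg] <;> norm_num
  by_cases h2 : u = j ∧ v = i
  · obtain ⟨rfl, rfl⟩ := h2
    have h' : (toggle v u G).Adj u v ↔ ¬ G.Adj u v := by rw [h]; tauto
    by_cases hg : G.Adj u v <;> simp [adj, hij, hij.symm, h', hg, G.adj_comm v u] <;> norm_num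
  have h' : (toggle i j G).Adj u v ↔ G.Adj u v := by rw [h]; tauto
  have e : (((if u = i then 1 else 0) * (if v = j then 1 else 0) +
        (if u = j then 1 else 0) * (if v = i then 1 else 0)) : ℝ) = 0 := by
    split_ifs <;> first | (norm_num; done) | (exfalso; tauto)
  rw [e, mul_zero, sub_zero]
  unfold adj
  split_ifs <;> first | rfl | (exfalso; tauto)

theorem deg_toggle (hij : i ≠ j) (G : SimpleGraph (Fin n)) (u : Fin n) :
    deg (toggle i j G) u = deg G u - 2 * adj G i j *
      ((if u = i then 1 else 0) + (if u = j then 1 else 0)) := by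
  simp only [deg, adj_toggle hij, Finset.sum_sub_distrib, ← Finset.mul_sum,
    Finset.sum_add_distrib]
  simp

/-- The local field felt by the pair `i j` at `θ = 1 / 2`. -/
noncomputable def localField (β : Fin n → ℝ) (i j : Fin n) (G : SimpleGraph (Fin n)) : ℝ :=
  (deg G i + deg G j - 2 * adj G i j) / (2 * ((n : ℝ) - 1)) + (β i + β j) / 2

theorem adj_toggle_self (hij : i ≠ j) (G : SimpleGraph (Fin n)) :
    adj (toggle i j G) i j = - adj G i j := by
  rw [adj_toggle hij]; simp [hij]; ring

theorem localField_toggle (hij : i ≠ j) (β : Fin n → ℝ) (G : SimpleGraph (Fin n)) :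
    localField β i j (toggle i j G) = localField β i j G := by
  unfold localField
  rw [deg_toggle hij, deg_toggle hij, adj_toggle_self hij]
  simp only [if_true, hij, hij.symm, if_false]
  ring

theorem weight_eq_weight_toggle_mul (hij : i ≠ j) (β : Fin n → ℝ) (G : SimpleGraph (Fin n)) :
    weight (1 / 2) β G =
      weight (1 / 2) β (toggle i j G) * exp (2 * adj G i j * localField β i j G) := by
  rw [weight, weight, ← Real.exp_add]
  congr 1
  rcases eq_or_ne ((n : ℝ) - 1) 0 with h0 | h0
  · exfalso
    have : n = 1 := by exact_mod_cast sub_eq_zero.1 h0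
    subst this
    exact hij (Subsingleton.elim _ _)
  have hb : ∑ u, β u * deg (toggle i j G) u =
      ∑ u, β u * deg G u - 2 * adj G i j * (β i + β j) := by
    simp only [deg_toggle hij, mul_sub, Finset.sum_sub_distrib]
    congr 1
    simp only [mul_left_comm (β _), ← Finset.mul_sum, mul_add, Finset.sum_add_distrib]
    simp
  have ht : twoStars (toggle i j G) =
      twoStars G - 2 * adj G i j * (deg G i + deg G j - 2 * adj G i j) := by
    have e : ∀ u, (deg (toggle i j G) u ^ 2 - ((n : ℝ) - 1)) / 2 =
        (deg G u ^ 2 - ((n : ℝ) - 1)) / 2 - 2 * adj G i j *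
          ((if u = i then deg G u - adj G i j else 0) +
            (if u = j then deg G u - adj G i j else 0)) := by
      intro u
      rw [deg_toggle hij]
      by_cases hi : u = i
      · have : u ≠ j := fun h => hij (hi.symm.trans h)
        simp only [hi, hij, if_true, if_false]; ring
      · by_cases hj : u = j
        · simp only [hj, hij.symm, if_true, if_false]; ring
        · simp only [hi, hj, if_false]; ring
    rw [twoStars_eq, twoStars_eq, Finset.sum_congr rfl fun u _ => e u, Finset.sum_sub_distrib,
      ← Finset.mul_sum, Finset.sum_add_distrib, Finset.sum_ite_eq', Finset.sum_ite_eq']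
    simp only [Finset.mem_univ, if_true]
    ring
  rw [hb, ht, localField]
  field_simp
  ring

/-- The conditional mean of `Y_ij` given all other pairs is the hyperbolic tangent of the local
field. -/
theorem expect_adj_eq_expect_tanh (hij : i ≠ j) (β : Fin n → ℝ) :
    expect (1 / 2) β (fun G => adj G i j) =
      expect (1 / 2) β (fun G => tanh (localField β i j G)) := by
  classical
  set F : SimpleGraph (Fin n) → ℝ := fun G =>
    mass (1 / 2) β G * (adj G i j - tanh (localField β i j G)) with hF
  -- The local field does not see the pair `i j`, so the contributions of `G` and its toggle cancel
  -- exactly.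
  have hpair : ∀ G, F G + F (toggle i j G) = 0 := by
    intro G
    simp only [hF, mass, localField_toggle hij, adj_toggle_self hij]
    rw [weight_eq_weight_toggle_mul hij β G]
    generalize localField β i j G = x
    have hs : adj G i j = 1 ∨ adj G i j = -1 := sq_eq_one_iff.1 (adj_sq G hij)
    have hx : exp (2 * x) * (1 - tanh x) = 1 + tanh x := by
      rw [Real.tanh_eq_sinh_div_cosh]
      have := (Real.cosh_pos x).ne'
      field_simp
      rw [Real.cosh_sub_sinh, Real.cosh_add_sinh, ← Real.exp_add]
      ring_nf
    have hx' : exp (-(2 * x)) * (1 + tanh x) = 1 - tanh x := by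
      rw [← hx, ← mul_assoc, ← Real.exp_add]; simp
    rcases hs with hs | hs <;> rw [hs]
    · rw [mul_one]
      linear_combination (weight (1 / 2) β (toggle i j G) / partitionFunction (1 / 2) β) * hx
    · rw [show 2 * (-1 : ℝ) * x = -(2 * x) by ring]
      linear_combination -(weight (1 / 2) β (toggle i j G) / partitionFunction (1 / 2) β) * hx'
  have h1 : ∑ G, F (toggle i j G) = ∑ G, F G :=
    Equiv.sum_comp (toggle_involutive i j).toPerm F
  have h2 : ∑ G, F G + ∑ G, F (toggle i j G) = 0 := by
    rw [← Finset.sum_add_distrib]; exact Finset.sum_eq_zero fun G _ => hpair G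
  have h3 : ∑ G, F G = 0 := by linarith
  have h4 : expect (1 / 2) β (fun G => adj G i j - tanh (localField β i j G)) = 0 := by
    rw [← h3]; unfold expect; exact Finset.sum_congr (by congr!) fun _ _ => rfl
  rw [expect_sub] at h4
  linarith

end Toggle

/-! ### Mean degrees at the critical point and their response to the field. -/

section Mean

variable {n : ℕ} {β β' δ : Fin n → ℝ} {i j : Fin n}

/-- The mean of the degree `k_i` at `θ = 1 / 2`. -/
noncomputable def meanDeg (β : Fin n → ℝ) (i : Fin n) : ℝ :=
  expect (1 / 2) β fun G => deg G i

/-- The mean of `Y_ij` at `θ = 1 / 2`. -/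
noncomputable def meanAdj (β : Fin n → ℝ) (i j : Fin n) : ℝ :=
  expect (1 / 2) β fun G => adj G i j

theorem meanDeg_eq_sum (β : Fin n → ℝ) (i : Fin n) : meanDeg β i = ∑ j, meanAdj β i j :=
  expect_sum _ _ _ fun j G => adj G i j

theorem meanAdj_self (β : Fin n → ℝ) (i : Fin n) : meanAdj β i i = 0 := by
  simp only [meanAdj, adj_self, expect_const]

theorem expect_localField (β β' : Fin n → ℝ) (i j : Fin n) :
    expect (1 / 2) β (localField β' i j) =
      (meanDeg β i + meanDeg β j - 2 * meanAdj β i j) / (2 * ((n : ℝ) - 1)) +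
        (β' i + β' j) / 2 := by
  have : localField β' i j = fun G => (2 * ((n : ℝ) - 1))⁻¹ *
      (deg G i + deg G j - 2 * adj G i j) + (β' i + β' j) / 2 := by
    funext G; rw [localField]; ring
  rw [this, expect_add, expect_const, expect_const_mul, expect_sub, expect_const_mul, expect_add,
    meanDeg, meanDeg, meanAdj]
  ring

theorem deg_sub_adj_mono (i j : Fin n) :
    Monotone fun G : SimpleGraph (Fin n) => deg G i - adj G i j := by
  intro G H h
  simp only [deg, ← Finset.sum_erase_eq_sub (Finset.mem_univ j)]
  exact Finset.sum_le_sum fun k _ => adj_mono i k h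

theorem localField_mono (hn : 2 ≤ n) (β : Fin n → ℝ) (i j : Fin n) :
    Monotone (localField β i j) := by
  intro G H h
  have hn' : (2 : ℝ) ≤ n := by exact_mod_cast hn
  have h1 := deg_sub_adj_mono i j h
  have h2 := deg_sub_adj_mono j i h
  simp only [adj_comm _ j i] at h1 h2
  unfold localField
  gcongr ?_ / _ + _
  · linarith
  · linarith

theorem coupling_nonneg (hn : 2 ≤ n) : 0 ≤ (1 / 2 : ℝ) / ((n : ℝ) - 1) := by
  have hn' : (2 : ℝ) ≤ n := by exact_mod_cast hn
  exact div_nonneg (by norm_num) (by linarith)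

/-- The gap `h_ij - tanh h_ij` is increasing in the graph, through the local field, and in the field
itself, so its expectation grows from `β` to `β'`. The mean spin therefore gains no more than the
mean local field. -/
theorem meanAdj_sub_le (hn : 2 ≤ n) (hij : i ≠ j) (h : ∀ u, β u ≤ β' u) :
    meanAdj β' i j - meanAdj β i j ≤
      expect (1 / 2) β' (localField β' i j) - expect (1 / 2) β (localField β i j) := by
  have h1 : expect (1 / 2) β (fun G => localField β i j G - tanh (localField β i j G)) ≤
      expect (1 / 2) β' (fun G => localField β i j G - tanh (localField β i j G)) :=
    expect_mono_field (coupling_nonneg hn) h fun G H hGH =>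
      monotone_sub_tanh (localField_mono hn β i j hGH)
  have h2 : expect (1 / 2) β' (fun G => localField β i j G - tanh (localField β i j G)) ≤
      expect (1 / 2) β' (fun G => localField β' i j G - tanh (localField β' i j G)) := by
    refine expect_mono fun G => monotone_sub_tanh ?_
    unfold localField
    linarith [h i, h j]
  have h3 := h1.trans h2
  rw [expect_sub, expect_sub, ← expect_adj_eq_expect_tanh hij, ← expect_adj_eq_expect_tanh hij]
    at h3
  simp only [meanAdj]
  linarith

theorem sum_erase_linearField (D δ : Fin n → ℝ) (M : Fin n → Fin n → ℝ) (N : ℝ) (hN : N = n - 1)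
    (hN0 : N ≠ 0) (hD : ∀ i, D i = ∑ j, M i j) (hM : ∀ i, M i i = 0) (i : Fin n) :
    ∑ j ∈ Finset.univ.erase i, ((D i + D j - 2 * M i j) / (2 * N) + (δ i + δ j) / 2) =
      ((N - 3) * D i + ∑ j, D j) / (2 * N) + ((N - 1) * δ i + ∑ j, δ j) / 2 := by
  rw [Finset.sum_erase_eq_sub (Finset.mem_univ i), Finset.sum_add_distrib, ← Finset.sum_div,
    ← Finset.sum_div, Finset.sum_sub_distrib, Finset.sum_add_distrib, Finset.sum_add_distrib,
    ← Finset.mul_sum, ← hD i, hM]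
  have : (n : ℝ) = N + 1 := by linarith
  simp only [Finset.sum_const, Finset.card_univ, Fintype.card_fin, nsmul_eq_mul, this]
  field_simp
  ring

/-- Criticality appears here: the coefficient of `∑ D` is `1 - 1 / N`, and the defect `1 / N` comes
from the self-exclusion term `-2 M i j`. -/
theorem sum_sum_erase_linearField (D δ : Fin n → ℝ) (M : Fin n → Fin n → ℝ) (N : ℝ)
    (hN : N = n - 1) (hN0 : N ≠ 0) (hD : ∀ i, D i = ∑ j, M i j) (hM : ∀ i, M i i = 0) :
    ∑ i, ∑ j ∈ Finset.univ.erase i, ((D i + D j - 2 * M i j) / (2 * N) + (δ i + δ j) / 2) =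
      (∑ i, D i) - (∑ i, D i) / N + N * ∑ i, δ i := by
  simp only [sum_erase_linearField D δ M N hN hN0 hD hM]
  rw [Finset.sum_add_distrib, ← Finset.sum_div, ← Finset.sum_div, Finset.sum_add_distrib,
    Finset.sum_add_distrib, ← Finset.mul_sum, ← Finset.mul_sum]
  have : (n : ℝ) = N + 1 := by linarith
  simp only [Finset.sum_const, Finset.card_univ, Fintype.card_fin, nsmul_eq_mul, this]
  field_simp
  ring

theorem sum_eq_sum_erase {D : Fin n → ℝ} {M : Fin n → Fin n → ℝ}
    (hD : ∀ i, D i = ∑ j, M i j) (hM : ∀ i, M i i = 0) (i : Fin n) :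
    D i = ∑ j ∈ Finset.univ.erase i, M i j := by
  rw [Finset.sum_erase_eq_sub (Finset.mem_univ i), hM, sub_zero, hD]

/-- Summing over all ordered pairs cancels `∑ D` and leaves `(∑ D) / N ≤ N ∑ δ`. A single row is not
degenerate: it carries only about half of `D i` on the right, so it can be solved for `D i` in terms
of the total. -/
theorem meanField_bounds (hn : 2 ≤ n) {D δ : Fin n → ℝ} {M : Fin n → Fin n → ℝ}
    (hD : ∀ i, D i = ∑ j, M i j) (hM : ∀ i, M i i = 0) (hδ : ∀ i, 0 ≤ δ i) (hD0 : ∀ i, 0 ≤ D i)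
    (h : ∀ i j, i ≠ j →
      M i j ≤ (D i + D j - 2 * M i j) / (2 * ((n : ℝ) - 1)) + (δ i + δ j) / 2) :
    (∑ i, D i ≤ ((n : ℝ) - 1) ^ 2 * ∑ i, δ i) ∧
      ∀ i, D i ≤ (∑ j, D j) / ((n : ℝ) - 1) + ((n : ℝ) - 1) * δ i + ∑ j, δ j := by
  have hn' : (2 : ℝ) ≤ n := by exact_mod_cast hn
  set N : ℝ := n - 1 with hN
  have hN1 : 1 ≤ N := by linarith
  have hN0 : 0 < N := by linarith
  have hrow : ∀ i, D i ≤
      ∑ j ∈ Finset.univ.erase i, ((D i + D j - 2 * M i j) / (2 * N) + (δ i + δ j) / 2) := by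
    intro i
    exact (sum_eq_sum_erase hD hM i).trans_le
      (Finset.sum_le_sum fun j hj => h i j (Finset.ne_of_mem_erase hj).symm)
  constructor
  · have h1 := Finset.sum_le_sum fun i (_ : i ∈ Finset.univ) => hrow i
    rw [sum_sum_erase_linearField D δ M N hN hN0.ne' hD hM] at h1
    have h2 : (∑ i, D i) / N ≤ N * ∑ i, δ i := by linarith
    rw [div_le_iff₀ hN0] at h2
    linarith
  · intro i
    have h1 := hrow i
    rw [sum_erase_linearField D δ M N hN hN0.ne' hD hM] at h1
    have hK : 0 ≤ ∑ j, D j := Finset.sum_nonneg fun j _ => hD0 j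
    have hs : 0 ≤ ∑ j, δ j := Finset.sum_nonneg fun j _ => hδ j
    have h2 : (N + 3) * D i ≤ (∑ j, D j) + N * ((N - 1) * δ i + ∑ j, δ j) := by
      have := mul_le_mul_of_nonneg_left h1 (show 0 ≤ 2 * N by linarith)
      field_simp at this
      linarith
    have h3 : N * D i ≤ N * ((∑ j, D j) / N + N * δ i + ∑ j, δ j) := by
      have e : N * ((∑ j, D j) / N + N * δ i + ∑ j, δ j) =
        (∑ j, D j) + N * (N * δ i + ∑ j, δ j) := by
        field_simp
        ring
      rw [e]
      nlinarith [hD0 i, mul_nonneg hN0.le (hδ i)]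
    exact le_of_mul_le_mul_left h3 hN0

theorem meanDeg_mono (hn : 2 ≤ n) (h : ∀ u, β u ≤ β' u) (i : Fin n) :
    meanDeg β i ≤ meanDeg β' i :=
  expect_mono_field (coupling_nonneg hn) h (deg_mono i)

theorem meanDeg_sub_bounds (hn : 2 ≤ n) (h : ∀ u, β u ≤ β' u) :
    (∑ i, (meanDeg β' i - meanDeg β i) ≤ ((n : ℝ) - 1) ^ 2 * ∑ i, (β' i - β i)) ∧
      ∀ i, meanDeg β' i - meanDeg β i ≤
        (∑ j, (meanDeg β' j - meanDeg β j)) / ((n : ℝ) - 1) + ((n : ℝ) - 1) * (β' i - β i) +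
          ∑ j, (β' j - β j) := by
  refine meanField_bounds hn (M := fun i j => meanAdj β' i j - meanAdj β i j) (fun i => ?_)
    (fun i => by simp [meanAdj_self]) (fun i => sub_nonneg.2 (h i))
    (fun i => sub_nonneg.2 (meanDeg_mono hn h i)) (fun i j hij => ?_)
  · rw [Finset.sum_sub_distrib, ← meanDeg_eq_sum, ← meanDeg_eq_sum]
  · refine (meanAdj_sub_le hn hij h).trans_eq ?_
    rw [expect_localField, expect_localField]
    ring

theorem meanDeg_add_le (hn : 2 ≤ n) (hδ : ∀ u, 0 ≤ δ u) (i : Fin n) :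
    meanDeg (β + δ) i ≤ meanDeg β i + 2 * n * ∑ u, δ u := by
  have hn' : (2 : ℝ) ≤ n := by exact_mod_cast hn
  obtain ⟨h1, h2⟩ := meanDeg_sub_bounds (β := β) (β' := β + δ) hn
    fun u => by simpa using hδ u
  simp only [Pi.add_apply, add_sub_cancel_left] at h1 h2
  have h3 : (∑ j, (meanDeg (β + δ) j - meanDeg β j)) / ((n : ℝ) - 1) ≤
      ((n : ℝ) - 1) * ∑ u, δ u := by
    rw [div_le_iff₀ (by linarith)]
    linarith
  have h4 : δ i ≤ ∑ u, δ u := Finset.single_le_sum (fun u _ => hδ u) (Finset.mem_univ i)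
  have h5 := mul_le_mul_of_nonneg_left h4 (show 0 ≤ (n : ℝ) - 1 by linarith)
  have h6 : 0 ≤ ∑ u, δ u := Finset.sum_nonneg fun u _ => hδ u
  nlinarith [h2 i]

/-! ### Symmetry at zero field -/

theorem adj_compl (G : SimpleGraph (Fin n)) (i j : Fin n) : adj Gᶜ i j = - adj G i j := by
  have := SimpleGraph.compl_adj G i j
  unfold adj
  split_ifs <;> first | (norm_num; done) | (exfalso; tauto)

/-- Complementation is the spin flip `Y ↦ -Y`, under which the two-star count is even; all means
vanish at zero field. -/
theorem mass_zero_compl (θ : ℝ) (G : SimpleGraph (Fin n)) : mass θ 0 Gᶜ = mass θ 0 G := by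
  simp [mass, weight, twoStars, adj_compl]

theorem meanAdj_zero (i j : Fin n) : meanAdj (0 : Fin n → ℝ) i j = 0 := by
  classical
  have h : ∑ G, mass (1 / 2) (0 : Fin n → ℝ) Gᶜ * adj Gᶜ i j =
      ∑ G, mass (1 / 2) (0 : Fin n → ℝ) G * adj G i j :=
    Equiv.sum_comp (Function.Involutive.toPerm (compl : SimpleGraph (Fin n) → _) compl_involutive)
      fun G => mass (1 / 2) (0 : Fin n → ℝ) G * adj G i j
  simp only [mass_zero_compl, adj_compl, mul_neg, Finset.sum_neg_distrib] at h
  have h2 : ∑ G, mass (1 / 2) (0 : Fin n → ℝ) G * adj G i j = 0 := by linarith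
  rw [← h2]; unfold meanAdj expect; exact Finset.sum_congr (by congr!) fun _ _ => rfl

theorem meanDeg_zero (i : Fin n) : meanDeg (0 : Fin n → ℝ) i = 0 := by
  simp [meanDeg_eq_sum, meanAdj_zero]

theorem meanDeg_nonneg (hn : 2 ≤ n) (hβ : ∀ u, 0 ≤ β u) (i : Fin n) : 0 ≤ meanDeg β i :=
  (meanDeg_zero i).symm.trans_le (meanDeg_mono hn hβ i)

theorem meanDeg_le (hn : 2 ≤ n) (hβ : ∀ u, 0 ≤ β u) (i : Fin n) :
    meanDeg β i ≤ (∑ j, meanDeg β j) / ((n : ℝ) - 1) + ((n : ℝ) - 1) * β i + ∑ j, β j := by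
  have h := (meanDeg_sub_bounds (β := 0) (β' := β) hn hβ).2 i
  simpa [meanDeg_zero] using h

/-! ### Sub-Gaussian bounds -/

theorem expect_half_sum (θ : ℝ) (β δ : Fin n → ℝ) :
    expect θ β (fun G => 1 / 2 * ∑ i, δ i * deg G i) =
      1 / 2 * ∑ i, δ i * expect θ β (fun G => deg G i) := by
  rw [expect_const_mul, expect_sum]
  simp only [expect_const_mul]

/-- After tilting, the exponent is half of `∑ δ_i` times the increase of the mean degree, and that
increase is at most `2 n ∑ δ`. -/
theorem expect_exp_sub_mean_le (hn : 2 ≤ n) (β : Fin n → ℝ) (hδ : ∀ u, 0 ≤ δ u) :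
    expect (1 / 2) β (fun G => exp (1 / 2 * ∑ i, δ i * (deg G i - meanDeg β i))) ≤
      exp (n * (∑ u, δ u) ^ 2) := by
  have h1 : (fun G => exp (1 / 2 * ∑ i, δ i * (deg G i - meanDeg β i))) =
      fun G => exp (-(1 / 2 * ∑ i, δ i * meanDeg β i)) *
        exp (1 / 2 * ∑ i, δ i * deg G i) := by
    funext G
    rw [← Real.exp_add]
    simp only [mul_sub, Finset.sum_sub_distrib]
    ring_nf
  rw [h1, expect_const_mul]
  refine (mul_le_mul_of_nonneg_left (expect_exp_tilt_le _ β δ) (Real.exp_pos _).le).trans ?_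
  rw [← Real.exp_add, Real.exp_le_exp, expect_half_sum]
  have h2 : ∑ i, δ i * meanDeg (β + δ) i ≤ ∑ i, δ i * (meanDeg β i + 2 * n * ∑ u, δ u) :=
    Finset.sum_le_sum fun i _ => mul_le_mul_of_nonneg_left (meanDeg_add_le hn hδ i) (hδ i)
  simp only [mul_add, Finset.sum_add_distrib, ← Finset.sum_mul] at h2
  simp only [meanDeg] at h2 ⊢
  linarith

/-- The lower-tail analogue: the tilt is by `-δ`, and the response bound is applied from the base
field `β - δ`. -/
theorem expect_exp_mean_sub_le (hn : 2 ≤ n) (β : Fin n → ℝ) (hδ : ∀ u, 0 ≤ δ u) :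
    expect (1 / 2) β (fun G => exp (1 / 2 * ∑ i, δ i * (meanDeg β i - deg G i))) ≤
      exp (n * (∑ u, δ u) ^ 2) := by
  have h1 : (fun G => exp (1 / 2 * ∑ i, δ i * (meanDeg β i - deg G i))) =
      fun G => exp (1 / 2 * ∑ i, δ i * meanDeg β i) *
        exp (1 / 2 * ∑ i, (-δ) i * deg G i) := by
    funext G
    rw [← Real.exp_add]
    simp only [mul_sub, Finset.sum_sub_distrib, Pi.neg_apply, neg_mul, Finset.sum_neg_distrib]
    ring_nf
  rw [h1, expect_const_mul]
  refine (mul_le_mul_of_nonneg_left (expect_exp_tilt_le _ β (-δ)) (Real.exp_pos _).le).trans ?_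
  rw [← Real.exp_add, Real.exp_le_exp, expect_half_sum]
  have h2 : ∑ i, δ i * meanDeg β i ≤ ∑ i, δ i * (meanDeg (β + -δ) i + 2 * n * ∑ u, δ u) := by
    refine Finset.sum_le_sum fun i _ => mul_le_mul_of_nonneg_left ?_ (hδ i)
    simpa using meanDeg_add_le (β := β + -δ) hn hδ i
  simp only [mul_add, Finset.sum_add_distrib, ← Finset.sum_mul] at h2
  simp only [meanDeg, Pi.neg_apply, neg_mul, Finset.sum_neg_distrib] at h2 ⊢
  linarith

end Mean

/-! ### Lower bound on testing errors, and Chernoff bounds for the total degree. -/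

section Testing

variable {n : ℕ} {β β' : Fin n → ℝ}

/-- No test separates the null from a simple alternative with a weak total signal. -/
theorem one_eighth_le_errors (hn : 2 ≤ n) (hβ : ∀ i, 0 ≤ β i) (hs : n * (∑ i, β i) ^ 2 ≤ 1)
    (T : SimpleGraph (Fin n) → Fin 2) :
    1 / 8 ≤ prob (1 / 2) (0 : Fin n → ℝ) {G | T G = 1} + prob (1 / 2) β {G | T G = 0} := by
  classical
  have hX : ∀ G : SimpleGraph (Fin n),
      1 / 2 * ∑ i, (-β) i * deg G i = -(1 / 2 * ∑ i, β i * deg G i) := by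
    intro G; simp
  have hsq : expect (1 / 2) β (fun G => exp (1 / 2 * ∑ i, (-β) i * deg G i)) ≤ 1 := by
    refine (expect_exp_tilt_le _ β (-β)).trans ?_
    rw [add_neg_cancel, expect_half_sum]
    have hz : ∀ i, expect (1 / 2) (0 : Fin n → ℝ) (fun G => deg G i) = 0 := meanDeg_zero
    simp only [hz, mul_zero, Finset.sum_const_zero, Real.exp_zero, le_refl]
  -- An unnormalised Hellinger affinity: the exponent `X = ∑ β_i k_i / 2` has mean at most `n (∑ β)²
  -- ≤ 1`, so Jensen gives at least `1 - 1/2`.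
  have hlow : 1 / 2 ≤ expect (1 / 2) β (fun G => exp (-(1 / 2 * (1 / 2 * ∑ i, β i * deg G i)))) := by
    refine le_trans ?_ (exp_expect_le _ _ _)
    rw [expect_neg, expect_const_mul, expect_half_sum]
    have h1 : ∑ i, β i * meanDeg β i ≤ ∑ i, β i * (2 * n * ∑ u, β u) := by
      refine Finset.sum_le_sum fun i _ => mul_le_mul_of_nonneg_left ?_ (hβ i)
      simpa [meanDeg_zero] using meanDeg_add_le (β := 0) hn hβ i
    rw [← Finset.sum_mul] at h1
    have h2 := Real.add_one_le_exp (-(1 / 2 * (1 / 2 * ∑ i, β i * meanDeg β i)))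
    simp only [meanDeg] at h1 h2
    nlinarith
  have hnull : expect (1 / 2) β (fun G => exp (1 / 2 * ∑ i, (-β) i * deg G i) *
      (if G ∈ {G | T G = 1} then 1 else 0)) ≤ prob (1 / 2) (0 : Fin n → ℝ) {G | T G = 1} := by
    rw [expect_exp_mul, add_neg_cancel, ← prob_eq_expect]
    exact mul_le_of_le_one_left (prob_nonneg _ _ _) hsq
  -- With `y = exp (-X / 2)`, both `1` and `y²` dominate `(y - 1/8 - y²/8) / 2`. Taking means with
  -- `E y ≥ 1/2` and `E y² ≤ 1` yields `1/8`.
  have hmain : expect (1 / 2) β (fun G =>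
      1 / 2 * (exp (-(1 / 2 * (1 / 2 * ∑ i, β i * deg G i))) -
        (1 / 8 + 1 / 8 * exp (1 / 2 * ∑ i, (-β) i * deg G i)))) ≤
      expect (1 / 2) β (fun G => exp (1 / 2 * ∑ i, (-β) i * deg G i) *
        (if G ∈ {G | T G = 1} then 1 else 0) + if G ∈ {G | T G = 0} then 1 else 0) := by
    refine expect_mono fun G => ?_
    rw [hX]
    generalize 1 / 2 * ∑ i, β i * deg G i = x
    have hy : exp (-x) = exp (-(1 / 2 * x)) ^ 2 := by rw [← Real.exp_nat_mul]; congr 1; ring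
    rw [hy]
    generalize exp (-(1 / 2 * x)) = y
    have hT : T G = 0 ∨ T G = 1 := by
      generalize T G = k
      fin_cases k <;> simp
    rcases hT with h | h
    · simp only [Set.mem_ofPred_eq, h, Fin.zero_ne_one, if_true, if_false]
      nlinarith [sq_nonneg (y - 4)]
    · simp only [Set.mem_ofPred_eq, h, Fin.one_eq_zero_iff, if_true]
      norm_num
      nlinarith [sq_nonneg (y - 1 / 4)]
  rw [expect_add, ← prob_eq_expect, expect_const_mul, expect_sub, expect_add, expect_const,
    expect_const_mul] at hmain
  linarith

theorem prob_le_prob_of_isLowerSet {θ : ℝ} (hθ : 0 ≤ θ / ((n : ℝ) - 1)) (h : ∀ i, β i ≤ β' i)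
    {E : Set (SimpleGraph (Fin n))} (hE : IsLowerSet E) : prob θ β' E ≤ prob θ β E := by
  classical
  have h1 := expect_mono_field (f := fun G => - if G ∈ E then (1 : ℝ) else 0) hθ h (by
    intro G H hGH
    by_cases hH : H ∈ E
    · simp [hH, hE hGH hH]
    · by_cases hG : G ∈ E <;> simp [hH, hG])
  rw [expect_neg, expect_neg, ← prob_eq_expect, ← prob_eq_expect] at h1
  linarith

/-- Chernoff's bound with the constant tilt `c`, for which `n (∑ δ)² = n³ c²`. -/
theorem prob_lt_sum_deg_le (hn : 2 ≤ n) {c : ℝ} (hc : 0 ≤ c) (L : ℝ) :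
    prob (1 / 2) (0 : Fin n → ℝ) {G | L < ∑ i, deg G i} ≤
      exp (n ^ 3 * c ^ 2 - c * L / 2) := by
  have h := expect_exp_sub_mean_le (δ := fun _ => c) hn (0 : Fin n → ℝ) fun _ => hc
  simp only [meanDeg_zero, sub_zero, ← Finset.mul_sum, Finset.sum_const, Finset.card_univ,
    Fintype.card_fin, nsmul_eq_mul] at h
  have h2 : prob (1 / 2) (0 : Fin n → ℝ) {G | L < ∑ i, deg G i} ≤
      expect (1 / 2) (0 : Fin n → ℝ)
        (fun G => exp (-(c * L / 2)) * exp (1 / 2 * (c * ∑ i, deg G i))) := by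
    refine prob_le_expect (fun G => by positivity) fun G (hG : L < _) => ?_
    rw [← Real.exp_add]
    refine Real.one_le_exp ?_
    nlinarith [mul_le_mul_of_nonneg_left hG.le hc]
  rw [expect_const_mul] at h2
  refine h2.trans ((mul_le_mul_of_nonneg_left h (Real.exp_pos _).le).trans_eq ?_)
  rw [← Real.exp_add]
  ring_nf

theorem prob_sum_deg_le_le (hn : 2 ≤ n) {c L : ℝ} (hc : 0 ≤ c)
    (hL : 2 * L ≤ ∑ i, meanDeg β i) :
    prob (1 / 2) β {G | ∑ i, deg G i ≤ L} ≤ exp (n ^ 3 * c ^ 2 - c * L / 2) := by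
  have h := expect_exp_mean_sub_le (δ := fun _ => c) hn β fun _ => hc
  simp only [← Finset.mul_sum, Finset.sum_sub_distrib, Finset.sum_const, Finset.card_univ,
    Fintype.card_fin, nsmul_eq_mul] at h
  have h2 : prob (1 / 2) β {G | ∑ i, deg G i ≤ L} ≤
      expect (1 / 2) β
        (fun G => exp (-(c * L / 2)) *
          exp (1 / 2 * (c * (∑ i, meanDeg β i - ∑ i, deg G i)))) := by
    refine prob_le_expect (fun G => by positivity) fun G (hG : _ ≤ L) => ?_
    rw [← Real.exp_add]
    refine Real.one_le_exp ?_
    have : c * L ≤ c * (∑ i, meanDeg β i - ∑ i, deg G i) :=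
      mul_le_mul_of_nonneg_left (by linarith) hc
    linarith
  rw [expect_const_mul] at h2
  refine h2.trans ((mul_le_mul_of_nonneg_left h (Real.exp_pos _).le).trans_eq ?_)
  rw [← Real.exp_add]
  ring_nf

/-! ### A lower bound for the mean total degree -/

theorem add_cube_le {a b : ℝ} (ha : 0 ≤ a) (hb : 0 ≤ b) : (a + b) ^ 3 ≤ 4 * (a ^ 3 + b ^ 3) := by
  nlinarith [mul_nonneg (add_nonneg ha hb) (sq_nonneg (a - b))]

theorem cube_le_six_mul_exp {u : ℝ} (hu : 0 ≤ u) : u ^ 3 ≤ 6 * exp u := by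
  have := Real.pow_div_factorial_le_exp u hu 3
  norm_num [Nat.factorial] at this
  linarith

/-- The local field is split into a centred fluctuation of scale `√n / (n - 1)`, with bounded
exponential moment, and its mean part. -/
theorem expect_localField_cube_le (hn : 2 ≤ n) (hβ : ∀ u, 0 ≤ β u) (i j : Fin n) :
    expect (1 / 2) β (fun G => max (localField β i j G) 0 ^ 3) ≤
      4 * ((√n / ((n : ℝ) - 1)) ^ 3 * (6 * exp 4) +
        ((meanDeg β i + meanDeg β j) / (2 * ((n : ℝ) - 1)) + (β i + β j) / 2 +
          1 / ((n : ℝ) - 1)) ^ 3) := by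
  have hn' : (2 : ℝ) ≤ n := by exact_mod_cast hn
  have hN : 0 < (n : ℝ) - 1 := by linarith
  have hr : 0 < √(n : ℝ) := Real.sqrt_pos.2 (by linarith)
  have hr2 : √(n : ℝ) ^ 2 = n := Real.sq_sqrt (by linarith)
  set q := (meanDeg β i + meanDeg β j) / (2 * ((n : ℝ) - 1)) + (β i + β j) / 2 +
    1 / ((n : ℝ) - 1) with hq
  have hq0 : 0 ≤ q := by
    have := meanDeg_nonneg hn hβ i
    have := meanDeg_nonneg hn hβ j
    have := hβ i
    have := hβ j
    positivity
  set u : SimpleGraph (Fin n) → ℝ := fun G =>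
    (deg G i - meanDeg β i + (deg G j - meanDeg β j)) / (2 * √n) with hu
  have hexp : expect (1 / 2) β (fun G => exp (u G)) ≤ exp 4 := by
    -- The tilt has total mass `2 / √n`, so the sub-Gaussian exponent is `n * (4 / n) = 4`.
    have h := expect_exp_sub_mean_le (δ := fun v => (if v = i then 1 / √n else 0) +
      (if v = j then 1 / √n else 0)) hn β fun v => by positivity
    simp only [add_mul, ite_mul, zero_mul, Finset.sum_add_distrib, Finset.sum_ite_eq',
      Finset.mem_univ, if_true] at h
    convert h using 2
    · funext G
      rw [hu]
      congr 1
      field_simp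
    · rw [show (1 / √(n : ℝ) + 1 / √n) ^ 2 = 4 / √n ^ 2 by field_simp; norm_num, hr2]
      field_simp
  have hpt : ∀ G, max (localField β i j G) 0 ^ 3 ≤
      4 * (√n / ((n : ℝ) - 1)) ^ 3 * 6 * exp (u G) + 4 * q ^ 3 := by
    intro G
    have h1 : localField β i j G ≤ √n / ((n : ℝ) - 1) * u G + q := by
      have e : √n / ((n : ℝ) - 1) * u G + q - localField β i j G =
          (1 + adj G i j) / ((n : ℝ) - 1) := by
        rw [hu, hq, localField]
        field_simp
        ring
      have := neg_one_le_adj G i j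
      have : 0 ≤ (1 + adj G i j) / ((n : ℝ) - 1) := div_nonneg (by linarith) hN.le
      linarith
    have h2 : max (localField β i j G) 0 ≤ √n / ((n : ℝ) - 1) * max (u G) 0 + q := by
      refine max_le (h1.trans ?_) (by positivity)
      gcongr
      exact le_max_left _ _
    have h3 : max (u G) 0 ^ 3 ≤ 6 * exp (u G) := by
      rcases le_total (u G) 0 with h | h
      · rw [max_eq_right h, zero_pow three_ne_zero]
        positivity
      · rw [max_eq_left h]
        exact cube_le_six_mul_exp h
    calc _ ≤ (√n / ((n : ℝ) - 1) * max (u G) 0 + q) ^ 3 := by gcongr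
      _ ≤ 4 * ((√n / ((n : ℝ) - 1) * max (u G) 0) ^ 3 + q ^ 3) :=
        add_cube_le (by positivity) hq0
      _ = 4 * (√n / ((n : ℝ) - 1)) ^ 3 * max (u G) 0 ^ 3 + 4 * q ^ 3 := by ring
      _ ≤ 4 * (√n / ((n : ℝ) - 1)) ^ 3 * (6 * exp (u G)) + 4 * q ^ 3 := by gcongr
      _ = _ := by ring
  refine (expect_mono hpt).trans ?_
  rw [expect_add, expect_const_mul, expect_const]
  have : 4 * (√n / ((n : ℝ) - 1)) ^ 3 * 6 * expect (1 / 2) β (fun G => exp (u G)) ≤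
    4 * (√n / ((n : ℝ) - 1)) ^ 3 * 6 * exp 4 := by gcongr
  linarith

/-- Summing `tanh x ≥ x - x₊³ / 2` over pairs cancels the total mean degree at criticality, so the
field is balanced by the small defect and the cubic terms alone. -/
theorem field_le_meanDeg_add_cubes (hn : 2 ≤ n) (β : Fin n → ℝ) :
    ((n : ℝ) - 1) * ∑ i, β i ≤ (∑ i, meanDeg β i) / ((n : ℝ) - 1) +
      ∑ i, ∑ j ∈ Finset.univ.erase i,
        expect (1 / 2) β (fun G => max (localField β i j G) 0 ^ 3) / 2 := by
  have hn' : (2 : ℝ) ≤ n := by exact_mod_cast hn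
  have h := sum_sum_erase_linearField (meanDeg β) β (meanAdj β) ((n : ℝ) - 1) rfl
    (by linarith) (meanDeg_eq_sum β) (meanAdj_self β)
  have h2 : ∑ i, ∑ j ∈ Finset.univ.erase i,
      ((meanDeg β i + meanDeg β j - 2 * meanAdj β i j) / (2 * ((n : ℝ) - 1)) + (β i + β j) / 2) ≤
      ∑ i, ∑ j ∈ Finset.univ.erase i,
        (meanAdj β i j + expect (1 / 2) β (fun G => max (localField β i j G) 0 ^ 3) / 2) := by
    refine Finset.sum_le_sum fun i _ => Finset.sum_le_sum fun j hj => ?_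
    have hij : i ≠ j := (Finset.ne_of_mem_erase hj).symm
    rw [← expect_localField, meanAdj, expect_adj_eq_expect_tanh hij]
    have h3 : expect (1 / 2) β (fun G => localField β i j G -
        1 / 2 * max (localField β i j G) 0 ^ 3) ≤
        expect (1 / 2) β (fun G => tanh (localField β i j G)) :=
      expect_mono fun G => by have := sub_cube_le_tanh (localField β i j G); linarith
    rw [expect_sub, expect_const_mul] at h3
    linarith
  simp only [Finset.sum_add_distrib] at h h2
  simp only [← sum_eq_sum_erase (meanDeg_eq_sum β) (meanAdj_self β)] at h2
  linarith

/-- `meanDeg_le` replaces individual mean degrees by their total, and `β u ≤ A` makes the cubes of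
the field linear in `β`; what remains involves only the two totals, `n` and `A`. -/
theorem field_le_meanDeg (hn : 2 ≤ n) {A : ℝ} (hβ : ∀ u, 0 ≤ β u) (hA : ∀ u, β u ≤ A) :
    (n : ℝ) * (∑ i, β i) / 2 ≤ 2 * (∑ i, meanDeg β i) / n + 96 * exp 4 * √n +
      8 * (n : ℝ) ^ 2 * (4 * (∑ i, meanDeg β i) / (n : ℝ) ^ 2 + 2 * (∑ i, β i) / n + 2 / n) ^ 3 +
      64 * A ^ 2 * (n * ∑ i, β i) := by
  have hn' : (2 : ℝ) ≤ n := by exact_mod_cast hn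
  have hn0 : (0 : ℝ) < n := by linarith
  have hN : 0 < (n : ℝ) - 1 := by linarith
  have hNn : (n : ℝ) / 2 ≤ n - 1 := by linarith
  have hr : 0 < √(n : ℝ) := Real.sqrt_pos.2 (by linarith)
  have hr2 : √(n : ℝ) ^ 2 = n := Real.sq_sqrt (by linarith)
  have hinv : 1 / ((n : ℝ) - 1) ≤ 2 / n := by
    rw [div_le_div_iff₀ hN hn0]; linarith
  set K := ∑ i, meanDeg β i with hK
  set σ := ∑ i, β i with hσ
  have hK0 : 0 ≤ K := Finset.sum_nonneg fun i _ => meanDeg_nonneg hn hβ i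
  have hσ0 : 0 ≤ σ := Finset.sum_nonneg fun i _ => hβ i
  set κ := 4 * K / (n : ℝ) ^ 2 + 2 * σ / n + 2 / n with hκ
  have hκ0 : 0 ≤ κ := by positivity
  have h := field_le_meanDeg_add_cubes hn β
  rw [← hK, ← hσ] at h
  have hA0 : ∀ i : Fin n, 0 ≤ A := fun i => (hβ i).trans (hA i)
  have hterm : ∀ i, ∀ j ∈ Finset.univ.erase i,
      expect (1 / 2) β (fun G => max (localField β i j G) 0 ^ 3) / 2 ≤
        (96 * exp 4 * √n / n ^ 2 + 8 * κ ^ 3) + 32 * A ^ 2 * β i + 32 * A ^ 2 * β j := by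
    intro i j _
    refine (div_le_div_of_nonneg_right (expect_localField_cube_le hn hβ i j) (by norm_num)).trans ?_
    have e1 : (√n / ((n : ℝ) - 1)) ^ 3 ≤ 8 * √n / n ^ 2 := by
      have : √n / ((n : ℝ) - 1) ≤ √n * (2 / n) := by
        rw [div_eq_mul_one_div]; gcongr
      calc _ ≤ (√n * (2 / n)) ^ 3 := by gcongr
        _ = 8 * √n * √n ^ 2 / n ^ 3 := by ring
        _ = _ := by rw [hr2]; field_simp
    have e2 : (meanDeg β i + meanDeg β j) / (2 * ((n : ℝ) - 1)) + (β i + β j) / 2 +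
        1 / ((n : ℝ) - 1) ≤ κ + (β i + β j) := by
      have m1 := meanDeg_le hn hβ i
      have m2 := meanDeg_le hn hβ j
      rw [← hK, ← hσ] at m1 m2
      have m3 : (meanDeg β i + meanDeg β j) / (2 * ((n : ℝ) - 1)) ≤
          K * (1 / ((n : ℝ) - 1)) ^ 2 + (β i + β j) / 2 + σ * (1 / ((n : ℝ) - 1)) := by
        rw [div_le_iff₀ (by positivity)]
        have : (K * (1 / ((n : ℝ) - 1)) ^ 2 + (β i + β j) / 2 + σ * (1 / ((n : ℝ) - 1))) *
          (2 * ((n : ℝ) - 1)) = 2 * (K / ((n : ℝ) - 1)) + ((n : ℝ) - 1) * (β i + β j) + 2 * σ := by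
          field_simp
        rw [this]
        linarith
      have m4 : K * (1 / ((n : ℝ) - 1)) ^ 2 ≤ K * (2 / n) ^ 2 := by gcongr
      have m5 : σ * (1 / ((n : ℝ) - 1)) ≤ σ * (2 / n) := by gcongr
      have m6 : κ = K * (2 / n) ^ 2 + σ * (2 / n) + 2 / n := by rw [hκ]; ring
      linarith
    have e3 : 0 ≤ (meanDeg β i + meanDeg β j) / (2 * ((n : ℝ) - 1)) + (β i + β j) / 2 +
        1 / ((n : ℝ) - 1) := by
      have := meanDeg_nonneg hn hβ i
      have := meanDeg_nonneg hn hβ j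
      have := hβ i
      have := hβ j
      positivity
    have hb0 : 0 ≤ β i + β j := add_nonneg (hβ i) (hβ j)
    have e4 : (κ + (β i + β j)) ^ 3 ≤ 4 * (κ ^ 3 + 4 * A ^ 2 * (β i + β j)) := by
      refine (add_cube_le hκ0 hb0).trans ?_
      have : (β i + β j) ^ 2 ≤ (2 * A) ^ 2 := by
        have := hA i
        have := hA j
        gcongr
        linarith
      nlinarith [mul_le_mul_of_nonneg_right this hb0]
    have e5 := (pow_le_pow_left₀ e3 e2 3).trans e4
    have e6 := mul_le_mul_of_nonneg_right e1 (show 0 ≤ 6 * exp 4 by positivity)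
    have e7 : 96 * exp 4 * √n / n ^ 2 = 2 * (8 * √n / n ^ 2 * (6 * exp 4)) := by ring
    rw [e7]
    linarith
  have hsum : ∑ i, ∑ j ∈ Finset.univ.erase i,
      expect (1 / 2) β (fun G => max (localField β i j G) 0 ^ 3) / 2 ≤
      ∑ i, ∑ j, ((96 * exp 4 * √n / n ^ 2 + 8 * κ ^ 3) + 32 * A ^ 2 * β i + 32 * A ^ 2 * β j) := by
    refine Finset.sum_le_sum fun i _ => (Finset.sum_le_sum (hterm i)).trans ?_
    refine Finset.sum_le_sum_of_subset_of_nonneg (Finset.erase_subset _ _) fun j _ _ => ?_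
    have := hβ i
    have := hβ j
    positivity
  simp only [Finset.sum_add_distrib, ← Finset.mul_sum, Finset.sum_const, Finset.card_univ,
    Fintype.card_fin, nsmul_eq_mul, ← hσ] at hsum
  have h1 : K / ((n : ℝ) - 1) ≤ 2 * K / n := by
    have : K * (1 / ((n : ℝ) - 1)) ≤ K * (2 / n) := by gcongr
    calc _ = K * (1 / ((n : ℝ) - 1)) := by ring
      _ ≤ _ := this
      _ = _ := by ring
  have h2 : (n : ℝ) * σ / 2 ≤ ((n : ℝ) - 1) * σ := by nlinarith
  have h3 : (n : ℝ) * (n * (96 * exp 4 * √n / n ^ 2)) = 96 * exp 4 * √n := by field_simp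
  nlinarith

end Testing

/-! ### Asymptotics -/

theorem tendsto_natCast_rpow_zero {y : ℝ} (hy : y < 0) :
    Tendsto (fun n : ℕ => (n : ℝ) ^ y) atTop (𝓝 0) := by
  have := (tendsto_rpow_neg_atTop (neg_pos.2 hy)).comp tendsto_natCast_atTop_atTop
  simpa [Function.comp_def] using this

theorem tendsto_natCast_rpow_atTop {y : ℝ} (hy : 0 < y) :
    Tendsto (fun n : ℕ => (n : ℝ) ^ y) atTop atTop :=
  (tendsto_rpow_atTop hy).comp tendsto_natCast_atTop_atTop

/-- The vector with entry `A` on `S` and `0` elsewhere. -/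
noncomputable def block {n : ℕ} (S : Finset (Fin n)) (A : ℝ) (i : Fin n) : ℝ :=
  if i ∈ S then A else 0

/-! ### Blocks as least favourable alternatives. -/

section Block

variable {n : ℕ} {S : Finset (Fin n)} {A : ℝ}

theorem sum_block (S : Finset (Fin n)) (A : ℝ) : ∑ i, block S A i = S.card * A := by
  simp [block]

theorem block_nonneg (hA : 0 ≤ A) (i : Fin n) : 0 ≤ block S A i := by
  unfold block; split_ifs <;> simp [hA]

theorem block_le (hA : 0 ≤ A) (i : Fin n) : block S A i ≤ A := by
  unfold block; split_ifs <;> simp [hA]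

theorem support_block (hA : 0 < A) : Function.support (block S A) = S := by
  ext i; simp [block, hA.ne']

theorem block_mem_alternatives (hA : 0 < A) {s : ℝ} (hs : s ≤ S.card) :
    block S A ∈ alternatives n 0 s A := by
  refine ⟨block S A, fun i => (zero_add _).symm, ?_, fun i hi => ?_⟩
  · rwa [support_block hA, Set.ncard_coe_finset]
  · rw [support_block hA, Finset.mem_coe] at hi
    simp [block, hi]

theorem exists_block_le (hA : 0 < A) {s : ℝ} {β : Fin n → ℝ} (hβ : β ∈ alternatives n 0 s A) :
    ∃ S : Finset (Fin n), S.card = ⌈s⌉₊ ∧ ∀ i, block S A i ≤ β i := by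
  classical
  obtain ⟨μ, h1, h2, h3⟩ := hβ
  rw [Set.ncard_eq_toFinset_card'] at h2
  obtain ⟨S, hS, hc⟩ := Finset.exists_subset_card_eq (Nat.ceil_le.2 h2)
  refine ⟨S, hc, fun i => ?_⟩
  rw [h1, zero_add]
  unfold block
  split_ifs with hi
  · exact h3 i (by simpa using hS hi)
  · by_cases hm : μ i = 0
    · exact hm.ge
    · exact hA.le.trans (h3 i hm)

end Block

theorem ceil_rpow_le_two_mul {b : ℝ} (hb : 0 ≤ b) {n : ℕ} (hn : 1 ≤ n) :
    (⌈(n : ℝ) ^ b⌉₊ : ℝ) ≤ 2 * (n : ℝ) ^ b := by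
  have h1 : 1 ≤ (n : ℝ) ^ b := Real.one_le_rpow (by exact_mod_cast hn) hb
  have := (Nat.ceil_lt_add_one (zero_le_one.trans h1)).le
  linarith

/-! ### Bounds on the risk and the two regimes. -/

theorem risk_nonneg {n : ℕ} (θ β₀ s A : ℝ) (T : SimpleGraph (Fin n) → Fin 2) :
    0 ≤ risk θ β₀ s A T := by
  refine add_nonneg (prob_nonneg _ _ _) (Real.sSup_nonneg ?_)
  rintro _ ⟨β, _, rfl⟩
  exact prob_nonneg _ _ _

theorem risk_le_two {n : ℕ} (θ β₀ s A : ℝ) (T : SimpleGraph (Fin n) → Fin 2) :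
    risk θ β₀ s A T ≤ 2 := by
  have h : sSup ((fun β => prob θ β {G | T G = 0}) '' alternatives n β₀ s A) ≤ 1 := by
    refine Real.sSup_le ?_ zero_le_one
    rintro _ ⟨β, _, rfl⟩
    exact prob_le_one _ _ _
  have := prob_le_one θ (fun _ => β₀) {G | T G = 1}
  unfold risk
  linarith

theorem one_eighth_le_risk {n : ℕ} (hn : 2 ≤ n) {b A : ℝ} (hb₀ : 0 ≤ b) (hb₁ : b ≤ 1) (hA : 0 < A)
    (hs : n * (2 * (n : ℝ) ^ b * A) ^ 2 ≤ 1) (T : SimpleGraph (Fin n) → Fin 2) :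
    1 / 8 ≤ risk (1 / 2) 0 ((n : ℝ) ^ b) A T := by
  have hn1 : (1 : ℝ) ≤ n := by exact_mod_cast (by omega : 1 ≤ n)
  have hle : ⌈(n : ℝ) ^ b⌉₊ ≤ (Finset.univ : Finset (Fin n)).card := by
    rw [Finset.card_univ, Fintype.card_fin, Nat.ceil_le]
    calc (n : ℝ) ^ b ≤ (n : ℝ) ^ (1 : ℝ) := Real.rpow_le_rpow_of_exponent_le hn1 hb₁
      _ = n := Real.rpow_one _
  obtain ⟨S, -, hS⟩ := Finset.exists_subset_card_eq hle
  have hmem : block S A ∈ alternatives n 0 ((n : ℝ) ^ b) A :=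
    block_mem_alternatives hA (by rw [hS]; exact Nat.le_ceil _)
  have hsum : n * (∑ i, block S A i) ^ 2 ≤ 1 := by
    refine le_trans ?_ hs
    rw [sum_block, hS]
    have := ceil_rpow_le_two_mul hb₀ (by omega : 1 ≤ n)
    gcongr
  refine (one_eighth_le_errors hn (block_nonneg hA.le) hsum T).trans ?_
  refine add_le_add le_rfl (le_csSup ⟨1, ?_⟩ ⟨_, hmem, rfl⟩)
  rintro _ ⟨β, _, rfl⟩
  exact prob_le_one _ _ _

theorem asympNotPowerful_of_add_neg {b t : ℝ} (hb₀ : 0 ≤ b) (hb₁ : b ≤ 1) (h : b + t + 1 / 2 < 0)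
    (T : ∀ n, SimpleGraph (Fin n) → Fin 2) :
    AsympNotPowerful (1 / 2) 0 (fun n => (n : ℝ) ^ b) (fun n => (n : ℝ) ^ t) T := by
  have hlim := (tendsto_natCast_rpow_zero (y := 2 * (b + t + 1 / 2)) (by linarith)).const_mul 4
  rw [mul_zero] at hlim
  have hev : ∀ᶠ n : ℕ in atTop,
      1 / 8 ≤ risk (1 / 2) 0 ((n : ℝ) ^ b) ((n : ℝ) ^ t) (T n) := by
    filter_upwards [hlim.eventually_le_const one_pos, eventually_ge_atTop 2] with n h1 hn
    have hn0 : (0 : ℝ) < n := by exact_mod_cast (by omega : 0 < n)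
    refine one_eighth_le_risk hn hb₀ hb₁ (by positivity) (le_trans (le_of_eq ?_) h1) (T n)
    have e1 : (n : ℝ) ^ (2 * (b + t + 1 / 2)) = ((n : ℝ) ^ b) ^ 2 * ((n : ℝ) ^ t) ^ 2 * n := by
      rw [← Real.rpow_natCast, ← Real.rpow_natCast, ← Real.rpow_mul hn0.le, ← Real.rpow_mul hn0.le,
        ← Real.rpow_add hn0]
      nth_rewrite 3 [← Real.rpow_one (n : ℝ)]
      rw [← Real.rpow_add hn0]
      congr 1
      push_cast
      ring
    rw [e1]
    ring
  refine lt_of_lt_of_le (by norm_num : (0 : ℝ) < 1 / 8) (Filter.le_liminf_of_le ?_ hev)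
  -- A real `liminf` is meaningful only with this upper bound on the risk.
  exact (isBoundedUnder_of ⟨2, fun n => risk_le_two _ _ _ _ _⟩ :
    IsBoundedUnder (· ≤ ·) atTop _).isCoboundedUnder_ge

theorem totalDegreeTest_eq_one {n : ℕ} (L : ℝ) :
    {G : SimpleGraph (Fin n) | totalDegreeTest L G = 1} = {G | L < ∑ i, deg G i} := by
  ext G
  simp only [Set.mem_ofPred_eq, totalDegreeTest]
  split_ifs with h <;> simp [h]

theorem totalDegreeTest_eq_zero {n : ℕ} (L : ℝ) :
    {G : SimpleGraph (Fin n) | totalDegreeTest L G = 0} = {G | ∑ i, deg G i ≤ L} := by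
  ext G
  simp only [Set.mem_ofPred_eq, totalDegreeTest, ← not_lt]
  split_ifs with h <;> simp [h]

theorem risk_totalDegreeTest_le {n : ℕ} (hn : 2 ≤ n) {s A L c : ℝ} (hA : 0 < A) (hc : 0 ≤ c)
    (hL : ∀ S : Finset (Fin n), S.card = ⌈s⌉₊ → 2 * L ≤ ∑ i, meanDeg (block S A) i) :
    risk (1 / 2) 0 s A (totalDegreeTest (n := n) L) ≤ 2 * exp (n ^ 3 * c ^ 2 - c * L / 2) := by
  rw [two_mul]
  refine add_le_add ?_ (Real.sSup_le ?_ (Real.exp_pos _).le)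
  · rw [totalDegreeTest_eq_one]
    exact prob_lt_sum_deg_le hn hc L
  · rintro _ ⟨β, hβ, rfl⟩
    obtain ⟨S, hS, hle⟩ := exists_block_le hA hβ
    simp only [totalDegreeTest_eq_zero]
    refine (prob_le_prob_of_isLowerSet (coupling_nonneg hn) hle ?_).trans
      (prob_sum_deg_le_le hn hc (hL S hS))
    intro G H hHG (hG : _ ≤ L)
    exact (Finset.sum_le_sum fun i _ => deg_mono i hHG).trans hG

theorem add_add_cube_le {x y z : ℝ} (hx : 0 ≤ x) (hy : 0 ≤ y) (hz : 0 ≤ z) :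
    (x + y + z) ^ 3 ≤ 9 * (x ^ 3 + y ^ 3 + z ^ 3) := by
  nlinarith [mul_nonneg (add_nonneg hx hy) (sq_nonneg (x - y)),
    mul_nonneg (add_nonneg hx hz) (sq_nonneg (x - z)),
    mul_nonneg (add_nonneg hy hz) (sq_nonneg (y - z)),
    mul_nonneg (add_nonneg (add_nonneg hx hy) hz) (sq_nonneg (x - y)),
    mul_nonneg (add_nonneg (add_nonneg hx hy) hz) (sq_nonneg (x - z)),
    mul_nonneg (add_nonneg (add_nonneg hx hy) hz) (sq_nonneg (y - z))]

/-- The mean total degree exceeds `2 n ^ (3 / 2 + η)` under the least favourable alternatives. -/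
theorem eventually_le_sum_meanDeg_block {b t η : ℝ} (hb₀ : 0 ≤ b) (hb₁ : b < 1) (ht : t < 0)
    (hη : 0 < η) (h : b + t + 1 / 2 = 4 * η) :
    ∀ᶠ n : ℕ in atTop, ∀ S : Finset (Fin n), S.card = ⌈(n : ℝ) ^ b⌉₊ →
      2 * (n : ℝ) ^ (3 / 2 + η) ≤ ∑ i, meanDeg (block S ((n : ℝ) ^ t)) i := by
  -- These are the right-hand terms of `field_le_meanDeg` relative to `n σ`: `72 = 8 * 9` and `2304
  -- = 72 * 32` come from splitting the cube of a sum of three.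
  have hlim : Tendsto (fun n : ℕ => (4 + 96 * exp 4 + 72 * (512 + 8)) * (n : ℝ) ^ (-η) +
      2304 * (n : ℝ) ^ (2 * (b + t - 1)) + 64 * (n : ℝ) ^ (2 * t)) atTop (𝓝 0) := by
    have h1 := (tendsto_natCast_rpow_zero (y := -η) (by linarith)).const_mul
      (4 + 96 * exp 4 + 72 * (512 + 8))
    have h2 := (tendsto_natCast_rpow_zero (y := 2 * (b + t - 1)) (by linarith)).const_mul 2304
    have h3 := (tendsto_natCast_rpow_zero (y := 2 * t) (by linarith)).const_mul 64
    simpa using (h1.add h2).add h3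
  filter_upwards [hlim.eventually_lt_const (show (0 : ℝ) < 1 / 2 by norm_num),
    eventually_ge_atTop 2] with n hsmall hn S hS
  by_contra! hK
  have hn1 : (1 : ℝ) ≤ n := by exact_mod_cast (by omega : 1 ≤ n)
  have hn0 : (0 : ℝ) < n := by linarith
  have hA : 0 < (n : ℝ) ^ t := by positivity
  have hmain := field_le_meanDeg hn (block_nonneg (S := S) hA.le) (block_le hA.le)
  set K := ∑ i, meanDeg (block S ((n : ℝ) ^ t)) i
  have hK0 : 0 ≤ K := Finset.sum_nonneg fun i _ => meanDeg_nonneg hn (block_nonneg hA.le) i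
  have hσ := sum_block S ((n : ℝ) ^ t)
  rw [hS] at hσ
  set σ := ∑ i, block S ((n : ℝ) ^ t) i
  have hσ1 : (n : ℝ) ^ (b + t) ≤ σ := by
    rw [hσ, Real.rpow_add hn0]
    gcongr
    exact Nat.le_ceil _
  have hσ2 : σ ≤ 2 * (n : ℝ) ^ (b + t) := by
    rw [hσ, Real.rpow_add hn0, ← mul_assoc]
    gcongr
    exact ceil_rpow_le_two_mul hb₀ (by omega)
  clear_value K σ
  have hσ0 : 0 < σ := lt_of_lt_of_le (by positivity) hσ1
  -- The scale of `K³ / n⁴` when `K` is of order `n ^ (3/2 + η)`; it falls short of `n σ` by a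
  -- factor `n ^ (-η)`, which is why `η` is a quarter of the excess.
  set m := (n : ℝ) ^ (1 / 2 + 3 * η) with hm
  set w := (n : ℝ) * σ with hw
  have hw0 : 0 < w := by positivity
  have hmw : m ≤ (n : ℝ) ^ (-η) * w := by
    have : m = (n : ℝ) ^ (-η) * (n * (n : ℝ) ^ (b + t)) := by
      rw [← Real.rpow_one_add' hn0.le (by linarith), ← Real.rpow_add hn0, hm]
      congr 1
      linarith
    rw [this, hw]
    gcongr
  have hm1 : 1 ≤ m := Real.one_le_rpow hn1 (by linarith)
  have hsqrt : √(n : ℝ) ≤ m := by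
    rw [Real.sqrt_eq_rpow]
    exact Real.rpow_le_rpow_of_exponent_le hn1 (by linarith)
  have hKn : 2 * K / n ≤ 4 * m := by
    rw [div_le_iff₀ hn0]
    have : (n : ℝ) ^ (3 / 2 + η) ≤ m * n := by
      rw [hm, ← Real.rpow_add_one' hn0.le (by linarith)]
      exact Real.rpow_le_rpow_of_exponent_le hn1 (by linarith)
    linarith
  have hKc : (n : ℝ) ^ 2 * (4 * K / (n : ℝ) ^ 2) ^ 3 ≤ 512 * m := by
    have e : m * (n : ℝ) ^ 4 = ((n : ℝ) ^ (3 / 2 + η)) ^ 3 := by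
      rw [hm, ← Real.rpow_natCast (n : ℝ) 4, ← Real.rpow_add hn0, ← Real.rpow_natCast,
        ← Real.rpow_mul hn0.le]
      congr 1
      push_cast
      ring
    have h1 : K ^ 3 ≤ (2 * (n : ℝ) ^ (3 / 2 + η)) ^ 3 := by gcongr
    have h2 : (n : ℝ) ^ 2 * (4 * K / (n : ℝ) ^ 2) ^ 3 = 64 * K ^ 3 / (n : ℝ) ^ 4 := by
      field_simp
      ring
    rw [h2, div_le_iff₀ (by positivity)]
    nlinarith
  have hσc : (n : ℝ) ^ 2 * (2 * σ / n) ^ 3 ≤ 32 * (n : ℝ) ^ (2 * (b + t - 1)) * w := by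
    have h1 : σ / n ≤ 2 * (n : ℝ) ^ (b + t - 1) := by
      rw [div_le_iff₀ hn0, mul_assoc, ← Real.rpow_add_one hn0.ne']
      simpa using hσ2
    have h2 : (σ / n) ^ 2 ≤ 4 * (n : ℝ) ^ (2 * (b + t - 1)) := by
      calc _ ≤ (2 * (n : ℝ) ^ (b + t - 1)) ^ 2 := by gcongr
        _ = 4 * (n : ℝ) ^ (2 * (b + t - 1)) := by
          rw [mul_comm 2 (b + t - 1), Real.rpow_mul hn0.le, Real.rpow_two]
          ring
    have h3 : (n : ℝ) ^ 2 * (2 * σ / n) ^ 3 = 8 * (σ / n) ^ 2 * w := by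
      rw [hw]
      field_simp
      norm_num
    rw [h3]
    nlinarith
  have hnc : (n : ℝ) ^ 2 * (2 / n) ^ 3 ≤ 8 * m := by
    have h1 : (n : ℝ) ^ 2 * (2 / n) ^ 3 = 8 / n := by
      field_simp
      norm_num
    rw [h1, div_le_iff₀ hn0]
    nlinarith
  have hcube : (4 * K / (n : ℝ) ^ 2 + 2 * σ / n + 2 / n) ^ 3 ≤
      9 * ((4 * K / (n : ℝ) ^ 2) ^ 3 + (2 * σ / n) ^ 3 + (2 / n) ^ 3) := by
    have h1 : 0 ≤ 4 * K / (n : ℝ) ^ 2 := by positivity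
    have h2 : 0 ≤ 2 * σ / n := by positivity
    have h3 : 0 ≤ 2 / (n : ℝ) := by positivity
    exact add_add_cube_le h1 h2 h3
  have hcube' := mul_le_mul_of_nonneg_left hcube (show 0 ≤ 8 * (n : ℝ) ^ 2 by positivity)
  have hA2 : ((n : ℝ) ^ t) ^ 2 = (n : ℝ) ^ (2 * t) := by
    rw [mul_comm 2 t, Real.rpow_mul hn0.le, Real.rpow_two]
  rw [hA2] at hmain
  have hexp : 96 * exp 4 * √(n : ℝ) ≤ 96 * exp 4 * m := by gcongr
  have hfin : w / 2 ≤ ((4 + 96 * exp 4 + 72 * (512 + 8)) * (n : ℝ) ^ (-η) +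
      2304 * (n : ℝ) ^ (2 * (b + t - 1)) + 64 * (n : ℝ) ^ (2 * t)) * w := by
    have h1 : (4 + 96 * exp 4 + 72 * (512 + 8)) * m ≤
        (4 + 96 * exp 4 + 72 * (512 + 8)) * ((n : ℝ) ^ (-η) * w) := by gcongr
    linarith
  have hlt := mul_lt_mul_of_pos_right hsmall hw0
  linarith

theorem asympPowerful_totalDegreeTest {b t η : ℝ} (hb₀ : 0 ≤ b) (hb₁ : b < 1) (ht : t < 0)
    (hη : 0 < η) (h : b + t + 1 / 2 = 4 * η) :
    AsympPowerful (1 / 2) 0 (fun n => (n : ℝ) ^ b) (fun n => (n : ℝ) ^ t)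
      (fun n => totalDegreeTest ((n : ℝ) ^ (3 / 2 + η))) := by
  have hlim : Tendsto (fun n : ℕ => 2 * exp (1 - (n : ℝ) ^ η / 2)) atTop (𝓝 0) := by
    have h1 : Tendsto (fun n : ℕ => 1 - (n : ℝ) ^ η / 2) atTop atBot := by
      have := (tendsto_natCast_rpow_atTop hη).atTop_div_const (show (0 : ℝ) < 2 by norm_num)
      simpa [sub_eq_add_neg] using
        tendsto_atBot_add_const_left atTop 1 (tendsto_neg_atTop_atBot.comp this)
    simpa using (Real.tendsto_exp_atBot.comp h1).const_mul 2
  refine tendsto_of_tendsto_of_tendsto_of_le_of_le' tendsto_const_nhds hlim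
    (Eventually.of_forall fun n => risk_nonneg _ _ _ _ _) ?_
  filter_upwards [eventually_le_sum_meanDeg_block hb₀ hb₁ ht hη h, eventually_ge_atTop 2]
    with n hL hn
  have hn0 : (0 : ℝ) < n := by exact_mod_cast (by omega : 0 < n)
  -- This tilt makes the quadratic term `n³ c²` equal to `1`, while `c L` becomes `n ^ η`.
  refine (risk_totalDegreeTest_le hn (c := (n : ℝ) ^ (-(3 / 2) : ℝ)) (by positivity) (by positivity)
    hL).trans_eq ?_
  have e1 : (n : ℝ) ^ 3 * ((n : ℝ) ^ (-(3 / 2) : ℝ)) ^ 2 = 1 := by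
    rw [← Real.rpow_natCast, ← Real.rpow_natCast, ← Real.rpow_mul hn0.le, ← Real.rpow_add hn0]
    norm_num
  have e2 : (n : ℝ) ^ (-(3 / 2) : ℝ) * (n : ℝ) ^ (3 / 2 + η) = (n : ℝ) ^ η := by
    rw [← Real.rpow_add hn0]
    congr 1
    ring
  rw [e1, e2]

end TwoStar

theorem theorem5 (b t : ℝ) (hb₀ : 0 < b) (hb₁ : b < 1) (ht : t < 0) :
    (b + t + 1 / 2 < 0 →
      ∀ T : ∀ n, SimpleGraph (Fin n) → Fin 2,
        TwoStar.AsympNotPowerful (1 / 2) 0 (fun n => (n : ℝ) ^ b) (fun n => (n : ℝ) ^ t) T) ∧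
    (0 < b + t + 1 / 2 →
      ∃ L : ℕ → ℝ,
        Tendsto (fun n : ℕ => L n / (n : ℝ) ^ (3 / 2 : ℝ)) atTop atTop ∧
        TwoStar.AsympPowerful (1 / 2) 0 (fun n => (n : ℝ) ^ b) (fun n => (n : ℝ) ^ t)
          (fun n => TwoStar.totalDegreeTest (L n))) := by
  refine ⟨fun h T => TwoStar.asympNotPowerful_of_add_neg hb₀.le hb₁.le h T, fun h => ?_⟩
  have hη : 0 < (b + t + 1 / 2) / 4 := by linarith
  refine ⟨fun n => (n : ℝ) ^ (3 / 2 + (b + t + 1 / 2) / 4), ?_,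
    TwoStar.asympPowerful_totalDegreeTest hb₀.le hb₁ ht hη (by ring)⟩
  refine (TwoStar.tendsto_natCast_rpow_atTop hη).congr' ?_
  filter_upwards [eventually_gt_atTop 0] with n hn
  have hn0 : (0 : ℝ) < n := by exact_mod_cast hn
  rw [Real.rpow_add hn0, mul_div_cancel_left₀ _ (by positivity)]
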